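/- Let $p$ be a prime and let $G$ be a finite group with a split $BN$-pair of characteristic $p$. That is, $B,N\le G$ are subgroups such that, with $H:=B\cap N$: $G$ is generated by $B$ and $N$; $H$ is normal in $N$; $W:=N/H$ is generated by a set $S$ of elements $s$ with $s^2=1$; if $m\in N$ represents an element of $S$, then $mBm\neq B$ and $mBn\subseteq BmnB\cup BnB$ for all $n\in N$; $B=U\rtimes H$ where $U$ is a normal $p$-subgroup of $B$ and $H$ is abelian of order prime to $p$; and $\bigcap_{n\in N}nBn^{-1}=H$. Let $l$ be the length function on $W$ with respect to $S$, let $n_0\in N$ represent the element of maximal length of $W$, put $V:=n_0^{-1}Un_0$ and, for $s\in S$ with representative $n_s\in N$, put $U_s:=U\cap n_s^{-1}Vn_s$. Let $k$ be a field with $|U|\cdot 1_k\neq 0$, put $\underline{\mathfrak b}:=\sum_{b\in B}b\in kG$, and equip the left $kG$-module $kG\underline{\mathfrak b}\cong \mathrm{Ind}_B^G(k)$ with the symmetric $k$-bilinear form such that, for $g,g'\in G$, $\langle g\underline{\mathfrak b},g'\underline{\mathfrak b}\rangle=1$ if $gB=g'B$ and $0$ otherwise. For a submodule $X\subseteq kG\underline{\mathfrak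 b}$ let $X^\perp:=\{a\in kG\underline{\mathfrak b}\mid\langle a,x\rangle=0\text{ for all }x\in X\}$, which is again a submodule. For a group homomorphism $\sigma\colon U\to k^\times$ put $\underline{\mathfrak u}_\sigma:=\sum_{u\in U}\sigma(u)u$, $\sigma^*(u):=\sigma(u)^{-1}$, and $$\mathcal S_\sigma:=kG\,\underline{\mathfrak u}_\sigma n_0\underline{\mathfrak b}\subseteq kG\underline{\mathfrak b},\qquad D_\sigma:=\mathcal S_\sigma/(\mathcal S_\sigma\cap\mathcal S_{\sigma^*}^\perp).$$ Let $\sigma\colon U\to k^\times$ be a group homomorphism that is non-degenerate, i.e. its restriction to $U_s$ is non-trivial for every $s\in S$. Then: (i) If $M\subseteq kG\underline{\mathfrak b}$ is any submodule, then either $\mathcal S_\sigma\subseteq M$ or $M\subseteq\mathcal S_{\sigma^*}^\perp$. (ii) $\mathcal S_\sigma\not\subseteq\mathcal S_{\sigma^*}^\perp$, and $\mathcal S_\sigma\cap\mathcal S_{\sigma^*}^\perp\subsetneqq\mathcal S_\sigma$ is the unique maximal submodule of $\mathcal S_\sigma$. (iii) The $kG$-module $D_\sigma$ is absolutely irreducible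 (that is, $L\otimes_kD_\sigma$ is an irreducible $LG$-module for every extension field $L$ of $k$) and isomorphic to the contragredient dual of $D_{\sigma^*}$. (iv) $D_\sigma$ occurs with multiplicity $1$ as a composition factor of $kG\underline{\mathfrak b}$ and of $\mathcal S_\sigma$. -/

import Mathlib

universe u v w

/-! ### General module theory -/

/-- `OccursWithMultiplicity R M D m`: the `R`-module `M` has a composition series, and in every
composition series `0 = M₀ ⋖ M₁ ⋖ ⋯ ⋖ M_l = M` exactly `m` of the factors `Mᵢ₊₁ / Mᵢ` are
isomorphic to `D`. -/
def OccursWithMultiplicity (R : Type*) (M D : Type*) [Ring R] [AddCommGroup M] [Module R M]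
    [AddCommGroup D] [Module R D] (m : ℕ) : Prop :=
  (∃ s : CompositionSeries (Submodule R M), s.head = ⊥ ∧ s.last = ⊤) ∧
    ∀ s : CompositionSeries (Submodule R M), s.head = ⊥ → s.last = ⊤ →
      Nat.card {i : Fin s.length //
        Nonempty ((↥(s i.succ) ⧸ (s i.castSucc).submoduleOf (s i.succ)) ≃ₗ[R] D)} = m

/-- The extension of scalars `L ⊗ V` of a representation of `G` on a `k`-vector space `V`. -/
noncomputable def Representation.scalarExt {k : Type*} {G : Type*} {V : Type*} [Field k] [Group G]
    [AddCommGroup V] [Module k V] (ρ : Representation k G V) (L : Type*) [Field L] [Algebra k L] :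
    Representation L G (TensorProduct k L V) where
  toFun g := (ρ g).baseChange L
  map_one' := by
    rw [map_one, Module.End.one_eq_id, LinearMap.baseChange_id, Module.End.one_eq_id]
  map_mul' g h := by
    rw [map_mul, Module.End.mul_eq_comp, LinearMap.baseChange_comp, Module.End.mul_eq_comp]

/-- A `kG`-module `D` is absolutely irreducible if, for every extension field `L` of `k`, the
`LG`-module `L ⊗ D` is irreducible. -/
def IsAbsolutelyIrreducible.{w', u', v', x'} (k : Type u') (G : Type v') (D : Type x') [Field k]
    [Group G] [AddCommGroup D] [Module k D] [Module (MonoidAlgebra k G) D]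
    [IsScalarTower k (MonoidAlgebra k G) D] : Prop :=
  ∀ (L : Type w') [Field L] [Algebra k L],
    ((Representation.ofModule' (k := k) (G := G) D).scalarExt L).IsIrreducible

/-- The contragredient dual `Hom_k(D, k)` of a `kG`-module `D`, with `(g f)(x) = f(g⁻¹ x)`, as a
`kG`-module. -/
abbrev ContragredientDual (k : Type*) (G : Type*) (D : Type*) [Field k]
    [Group G] [AddCommGroup D] [Module k D] [Module (MonoidAlgebra k G) D]
    [IsScalarTower k (MonoidAlgebra k G) D] : Type _ :=
  (Representation.ofModule' (k := k) (G := G) D).dual.asModule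

/-! ### Groups with a split `BN`-pair -/

/-- A split `BN`-pair of characteristic `p` on a (finite) group `G`. Here `H = B ∩ N`,
`W = N / H`, and `S` is the distinguished set of generators of `W`. -/
structure SplitBNPair (G : Type u) [Group G] (p : ℕ) where
  /-- The subgroup `B`. -/
  B : Subgroup G
  /-- The subgroup `N`. -/
  N : Subgroup G
  /-- The subgroup `U`. -/
  U : Subgroup G
  /-- `G` is generated by `B` and `N`. -/
  sup_eq_top : B ⊔ N = ⊤
  /-- `H = B ∩ N` is normal in `N`. -/
  normal_H : ((B ⊓ N).subgroupOf N).Normal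
  /-- The generating set of the Weyl group `W = N / H`. -/
  S : Set (↥N ⧸ (B ⊓ N).subgroupOf N)
  /-- `W` is generated by `S`. -/
  closure_S : Subgroup.closure S = ⊤
  /-- The elements of `S` square to the identity. -/
  sq_S : ∀ s ∈ S, s * s = 1
  /-- If `n ∈ N` represents an element of `S`, then `n B n ≠ B`. -/
  conj_ne : ∀ n : N, (n : ↥N ⧸ (B ⊓ N).subgroupOf N) ∈ S →
    (fun b : G => (n : G) * b * (n : G)) '' (B : Set G) ≠ (B : Set G)
  /-- If `m ∈ N` represents an element of `S`, then `m B n ⊆ B m n B ∪ B n B` for all `n ∈ N`. -/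
  mul_subset : ∀ m n : N, (m : ↥N ⧸ (B ⊓ N).subgroupOf N) ∈ S →
    (fun b : G => (m : G) * b * (n : G)) '' (B : Set G) ⊆
      DoubleCoset.doubleCoset ((m : G) * (n : G)) (B : Set G) (B : Set G) ∪
        DoubleCoset.doubleCoset (n : G) (B : Set G) (B : Set G)
  /-- `U` is contained in `B`. -/
  U_le_B : U ≤ B
  /-- `U` is normal in `B`. -/
  normal_U : (U.subgroupOf B).Normal
  /-- `B = U H`. -/
  U_sup_H : U ⊔ (B ⊓ N) = B
  /-- `U ∩ H = 1`. -/
  U_inf_H : U ⊓ (B ⊓ N) = ⊥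
  /-- `U` is a `p`-group. -/
  isPGroup_U : IsPGroup p U
  /-- `H` is abelian. -/
  comm_H : ∀ x ∈ B ⊓ N, ∀ y ∈ B ⊓ N, x * y = y * x
  /-- `H` has order prime to `p`. -/
  coprime_H : (Nat.card ↥(B ⊓ N)).Coprime p
  /-- `⋂ n B n⁻¹ = H`, the intersection over all `n ∈ N`. -/
  iInf_conj : ⨅ n : N, B.map (MulAut.conj (n : G)).toMonoidHom = B ⊓ N

namespace SplitBNPair

variable {G : Type u} [Group G] {p : ℕ} (P : SplitBNPair G p)

/-- The group `W = N / H`. -/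
abbrev W : Type u := ↥P.N ⧸ (P.B ⊓ P.N).subgroupOf P.N

instance : ((P.B ⊓ P.N).subgroupOf P.N).Normal := P.normal_H

/-- The length function on `W` with respect to the generating set `S`. -/
noncomputable def length (x : P.W) : ℕ :=
  sInf {m : ℕ | ∃ l : List P.W, (∀ s ∈ l, s ∈ P.S) ∧ l.prod = x ∧ l.length = m}

/-- `n₀ ∈ N` represents an element of maximal length of `W`. -/
def RepresentsLongest (n₀ : P.N) : Prop :=
  ∀ x : P.W, P.length x ≤ P.length (n₀ : P.W)

/-- The subgroup `V = n₀⁻¹ U n₀`. -/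
def V (n₀ : P.N) : Subgroup G := P.U.map (MulAut.conj (n₀ : G)⁻¹).toMonoidHom

/-- The subgroup `U_w = U ∩ n⁻¹ V n`, where `n ∈ N` represents `w`. -/
def rootSubgroup (n₀ n : P.N) : Subgroup G :=
  P.U ⊓ (P.V n₀).map (MulAut.conj (n : G)⁻¹).toMonoidHom

section Modules

variable {k : Type v} [Field k]

/-- A linear character of `U` is non-degenerate if its restriction to `U_s` is non-trivial for
every `s ∈ S`. -/
def NonDegenerate (n₀ : P.N) (σ : P.U →* kˣ) : Prop :=
  ∀ n : P.N, (n : P.W) ∈ P.S → ∃ x : P.U, (x : G) ∈ P.rootSubgroup n₀ n ∧ σ x ≠ 1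

variable (k) in
/-- The element `b = ∑_{x ∈ B} x` of `kG`. -/
noncomputable def bSum : MonoidAlgebra k G :=
  ∑ᶠ x : P.B, MonoidAlgebra.of k G (x : G)

/-- The element `u_σ = ∑_{x ∈ U} σ(x) x` of `kG`. -/
noncomputable def uSum (σ : P.U →* kˣ) : MonoidAlgebra k G :=
  ∑ᶠ x : P.U, ((σ x : kˣ) : k) • MonoidAlgebra.of k G (x : G)

variable (k) in
/-- The left ideal `kG b` of `kG`. -/
noncomputable def permIdeal : Submodule (MonoidAlgebra k G) (MonoidAlgebra k G) :=
  Submodule.span (MonoidAlgebra k G) {P.bSum k}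

variable (k) in
/-- The left ideal `kG b`, regarded as a `kG`-module. -/
def PermModule : Type (max u v) := ↥(P.permIdeal k)

noncomputable instance : AddCommGroup (P.PermModule k) :=
  inferInstanceAs (AddCommGroup ↥(P.permIdeal k))

noncomputable instance : Module (MonoidAlgebra k G) (P.PermModule k) :=
  inferInstanceAs (Module (MonoidAlgebra k G) ↥(P.permIdeal k))

noncomputable instance : Module k (P.PermModule k) :=
  inferInstanceAs (Module k ↥(P.permIdeal k))

instance : IsScalarTower k (MonoidAlgebra k G) (P.PermModule k) :=
  inferInstanceAs (IsScalarTower k (MonoidAlgebra k G) ↥(P.permIdeal k))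

variable (k) in
/-- The inclusion of `kG b` in `kG`. -/
noncomputable def incl : P.PermModule k →ₗ[MonoidAlgebra k G] MonoidAlgebra k G :=
  (P.permIdeal k).subtype

variable (k) in
/-- The surjection `a ↦ a b` of `kG` onto `kG b`. -/
noncomputable def mulB : MonoidAlgebra k G →ₗ[MonoidAlgebra k G] P.PermModule k :=
  (LinearMap.toSpanSingleton (MonoidAlgebra k G) (MonoidAlgebra k G) (P.bSum k)).codRestrict
    (P.permIdeal k) fun a => Submodule.smul_mem _ a (Submodule.mem_span_singleton_self _)

theorem incl_mulB (a : MonoidAlgebra k G) : P.incl k (P.mulB k a) = a * P.bSum k := rfl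

theorem incl_smul (c : k) (x : P.PermModule k) : P.incl k (c • x) = c • P.incl k x := rfl

theorem mulB_surjective : Function.Surjective (P.mulB k) := by
  rintro ⟨x, hx⟩
  obtain ⟨a, rfl⟩ := Submodule.mem_span_singleton.mp hx
  exact ⟨a, rfl⟩

/-- The submodule `S_σ = kG u_σ n₀ b` of `kG b`. -/
noncomputable def jamesModule (n₀ : P.N) (σ : P.U →* kˣ) :
    Submodule (MonoidAlgebra k G) (P.PermModule k) :=
  Submodule.span (MonoidAlgebra k G)
    {P.mulB k (P.uSum σ * MonoidAlgebra.of k G (n₀ : G))}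

/-! ### The bilinear form on `kG b`

The coefficients of an element of `kG b` are constant on the cosets `g B`, so they may be read off
at arbitrary representatives of these cosets. The form is the one for which the elements `g b`, one
for each coset `g B`, are orthonormal; see `form_of_of`. -/

variable [Finite G]

variable (k) in
/-- The symmetric bilinear form on `kG b` given by `⟨x, y⟩ = ∑_{c ∈ G/B} x_c y_c`, where `x_c` is
the common value of the coefficients of `x` on the coset `c`. -/
noncomputable def form : LinearMap.BilinForm k (P.PermModule k) :=
  LinearMap.mk₂ k
    (fun x y => ∑ᶠ c : G ⧸ P.B, (P.incl k x).coeff c.out * (P.incl k y).coeff c.out)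
    (fun x x' y => by
      rw [← finsum_add_distrib (Set.toFinite _) (Set.toFinite _)]
      simp [add_mul])
    (fun a x y => by
      rw [smul_eq_mul, mul_finsum]
      simp [mul_assoc])
    (fun x y y' => by
      rw [← finsum_add_distrib (Set.toFinite _) (Set.toFinite _)]
      simp [mul_add])
    (fun a x y => by
      rw [smul_eq_mul, mul_finsum]
      simp [mul_left_comm])

theorem form_apply (x y : P.PermModule k) :
    P.form k x y =
      ∑ᶠ c : G ⧸ P.B, (P.incl k x).coeff c.out * (P.incl k y).coeff c.out := rfl

open Classical in
theorem coeff_of_mul_bSum (g h : G) :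
    (MonoidAlgebra.of k G g * P.bSum k).coeff h =
      if (g : G ⧸ P.B) = (h : G ⧸ P.B) then 1 else 0 := by
  have := Fintype.ofFinite P.B
  simp only [QuotientGroup.eq]
  rw [bSum, finsum_eq_sum_of_fintype, MonoidAlgebra.of_apply,
    MonoidAlgebra.coeff_single_mul_apply, MonoidAlgebra.coeff_sum, one_mul]
  simp only [MonoidAlgebra.of_apply, MonoidAlgebra.coeff_single, Finsupp.finsetSum_apply,
    Finsupp.single_apply]
  split_ifs with hb
  · rw [Finset.sum_eq_single_of_mem (⟨g⁻¹ * h, hb⟩ : P.B) (Finset.mem_univ _)]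
    · simp
    · intro x _ hx
      rw [if_neg]
      intro hx'
      exact hx (Subtype.ext hx')
  · refine Finset.sum_eq_zero fun x _ => if_neg fun hx => hb ?_
    rw [← hx]
    exact x.2

open Classical in
/-- `⟨g b, g' b⟩` is `1` if `g B = g' B`, and `0` otherwise. -/
theorem form_of_of (g g' : G) :
    P.form k (P.mulB k (MonoidAlgebra.of k G g)) (P.mulB k (MonoidAlgebra.of k G g')) =
      if (g : G ⧸ P.B) = (g' : G ⧸ P.B) then 1 else 0 := by
  have := Fintype.ofFinite (G ⧸ P.B)
  rw [form_apply, finsum_eq_sum_of_fintype]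
  simp only [incl_mulB, coeff_of_mul_bSum, QuotientGroup.out_eq']
  simp [eq_comm]

theorem coeff_congr (x : P.PermModule k) {g h : G} (hgh : (g : G ⧸ P.B) = (h : G ⧸ P.B)) :
    (P.incl k x).coeff g = (P.incl k x).coeff h := by
  classical
  obtain ⟨a, rfl⟩ := P.mulB_surjective x
  rw [incl_mulB]
  induction a using MonoidAlgebra.induction_on with
  | of a => rw [coeff_of_mul_bSum, coeff_of_mul_bSum, hgh]
  | add a b ha hb =>
    simp only [add_mul, MonoidAlgebra.coeff_add, Finsupp.add_apply]
    rw [ha, hb]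
  | smul r a ha =>
    simp only [smul_mul_assoc, MonoidAlgebra.coeff_smul, Finsupp.smul_apply]
    rw [ha]

/-- The form is `G`-invariant. -/
theorem form_smul_smul (g : G) (x y : P.PermModule k) :
    P.form k (MonoidAlgebra.of k G g • x) (MonoidAlgebra.of k G g • y) = P.form k x y := by
  rw [form_apply, form_apply]
  refine finsum_eq_of_bijective (fun c : G ⧸ P.B => g⁻¹ • c) (MulAction.bijective _) fun c => ?_
  have key (z : P.PermModule k) :
      (P.incl k (MonoidAlgebra.of k G g • z)).coeff c.out =
        (P.incl k z).coeff (g⁻¹ • c).out := by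
    rw [map_smul, smul_eq_mul, MonoidAlgebra.of_apply,
      MonoidAlgebra.coeff_single_mul_apply, one_mul]
    refine P.coeff_congr z ?_
    rw [QuotientGroup.out_eq', ← smul_eq_mul, ← MulAction.Quotient.smul_coe,
      QuotientGroup.out_eq']
  rw [key, key]

/-- The submodule `X^⊥ = {a ∈ kG b | ⟨a, x⟩ = 0 for all x ∈ X}`, for a submodule `X` of `kG b`. -/
noncomputable def perp (X : Submodule (MonoidAlgebra k G) (P.PermModule k)) :
    Submodule (MonoidAlgebra k G) (P.PermModule k) where
  carrier := {a | ∀ x ∈ X, P.form k a x = 0}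
  zero_mem' := fun x _ => by simp
  add_mem' := fun {a b} ha hb x hx => by
    rw [map_add, LinearMap.add_apply, ha x hx, hb x hx, add_zero]
  smul_mem' := fun r a ha x hx => by
    induction r using MonoidAlgebra.induction_on with
    | of g =>
      have h := P.form_smul_smul g a (MonoidAlgebra.of k G g⁻¹ • x)
      rw [← mul_smul, ← map_mul, mul_inv_cancel, map_one, one_smul] at h
      rw [h]
      exact ha _ (X.smul_mem _ hx)
    | add r s hr hs => rw [add_smul, map_add, LinearMap.add_apply, hr, hs, add_zero]
    | smul c r hr => rw [smul_assoc, map_smul, LinearMap.smul_apply, hr, smul_zero]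

/-- The submodule `S_σ ∩ S_{σ*}^⊥` of `S_σ`, where `σ* = σ⁻¹` is the pointwise inverse of `σ`. -/
noncomputable def jamesRadical (n₀ : P.N) (σ : P.U →* kˣ) :
    Submodule (MonoidAlgebra k G) (P.jamesModule n₀ σ) :=
  (P.perp (P.jamesModule n₀ σ⁻¹)).submoduleOf (P.jamesModule n₀ σ)

/-- The `kG`-module `D_σ = S_σ / (S_σ ∩ S_{σ*}^⊥)`. -/
abbrev jamesQuotient (n₀ : P.N) (σ : P.U →* kˣ) : Type _ :=
  ↥(P.jamesModule n₀ σ) ⧸ P.jamesRadical n₀ σ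

end Modules

end SplitBNPair

/-! Write `e_σ = u_σ n₀ b` for the generator of `S_σ`. Everything rests on `uSum_smul_eq`: on `kG b`
the element `u_σ` acts with rank one, `u_σ x = ⟨x, e_{σ*}⟩ e_σ`.

To see this, decompose `G` into the sets `U n B`. Since `u_σ u` is a multiple of `u_σ` for `u ∈ U`,
only the vectors `u_σ n b` matter. If `n` does not represent the longest element, some `s ∈ S`
satisfies `l(sn) > l(n)`, and then `n⁻¹ U_s n ⊆ B`. Hence `U_s` fixes `n b`, and as `σ` is
non-trivial on `U_s`, `u_σ n b = 0`. So `u_σ x` is a multiple of `e_σ`. The factor is found by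
pairing with `n₀ b`: `⟨e_σ, n₀ b⟩ = 1` because `U ∩ n₀ B n₀⁻¹ = 1`, and `u_σ` is adjoint to
`u_{σ*}`.

A submodule not orthogonal to `e_{σ*}` therefore contains `e_σ`, which is (i). Also `⟨e_σ, e_{σ*}⟩ =
|U| ≠ 0`, which gives (ii). The form induces a perfect pairing of `D_σ` with `D_{σ*}`, hence the
duality in (iii); a rank-one operator with cyclic image, whose functional has no non-zero `G`-stable
subspace in its kernel, forces irreducibility, and these properties survive base change. For (iv),
`u_σ` is non-zero on `D_σ` but kills every composition factor except the one at which `S_σ` enters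
the series.

The facts about `BN`-pairs used here (Bruhat decomposition, exchange condition, lengths around the
longest element, intersections of conjugates of `B`) are derived from the axioms. -/

namespace SplitBNPair

/-! ### Consequences of the `BN`-pair axioms. -/

section Bruhat

variable {G : Type u} [Group G] {p : ℕ} (P : SplitBNPair G p)

/-- The Bruhat cell `B w B`. -/
def cell (w : P.W) : Set G :=
  {g | ∃ n : P.N, (n : P.W) = w ∧ ∃ x ∈ P.B, ∃ y ∈ P.B, g = x * n * y}

variable {P}

theorem mul_mem_cell {w : P.W} {g b c : G} (hb : b ∈ P.B) (hc : c ∈ P.B) (hg : g ∈ P.cell w) :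
    b * g * c ∈ P.cell w := by
  obtain ⟨n, hn, x, hx, y, hy, rfl⟩ := hg
  exact ⟨n, hn, b * x, mul_mem hb hx, y * c, mul_mem hy hc, by group⟩

theorem coe_mem_cell (n : P.N) : (n : G) ∈ P.cell (n : P.W) :=
  ⟨n, rfl, 1, one_mem _, 1, one_mem _, by simp⟩

theorem coe_eq_coe_iff {n m : P.N} : (n : P.W) = m ↔ (n : G)⁻¹ * m ∈ P.B := by
  rw [QuotientGroup.eq, Subgroup.mem_subgroupOf, Subgroup.mem_inf]
  refine ⟨fun h => h.1, fun h => ⟨h, (n⁻¹ * m).2⟩⟩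

theorem mem_cell_iff {n : P.N} {g : G} :
    g ∈ P.cell (n : P.W) ↔ ∃ x ∈ P.B, ∃ y ∈ P.B, g = x * n * y := by
  refine ⟨?_, fun ⟨x, hx, y, hy, h⟩ => ⟨n, rfl, x, hx, y, hy, h⟩⟩
  rintro ⟨m, hm, x, hx, y, hy, rfl⟩
  refine ⟨x, hx, (n : G)⁻¹ * m * y, mul_mem (coe_eq_coe_iff.1 hm.symm) hy, by group⟩

theorem cell_one : P.cell 1 = P.B := by
  ext g
  rw [← QuotientGroup.mk_one, mem_cell_iff]
  constructor
  · rintro ⟨x, hx, y, hy, rfl⟩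
    simpa using mul_mem hx hy
  · exact fun h => ⟨g, h, 1, one_mem _, by simp⟩

theorem inv_mem_cell {w : P.W} {g : G} (hg : g ∈ P.cell w) : g⁻¹ ∈ P.cell w⁻¹ := by
  obtain ⟨n, rfl, x, hx, y, hy, rfl⟩ := hg
  exact ⟨n⁻¹, rfl, y⁻¹, inv_mem hy, x⁻¹, inv_mem hx, by simp [mul_assoc]⟩

theorem mul_mem_cell_or {s w : P.W} (hs : s ∈ P.S) {g h : G} (hg : g ∈ P.cell s)
    (hh : h ∈ P.cell w) : g * h ∈ P.cell (s * w) ∨ g * h ∈ P.cell w := by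
  obtain ⟨m, rfl, x, hx, y, hy, rfl⟩ := hg
  obtain ⟨n, rfl, x', hx', y', hy', rfl⟩ := hh
  have key := P.mul_subset m n hs ⟨y * x', mul_mem hy hx', rfl⟩
  have e : x * m * y * (x' * n * y') = x * (m * (y * x') * n) * y' := by group
  rw [e]
  refine key.imp (fun h => ?_) (fun h => ?_)
  · obtain ⟨a, ha, b, hb, h⟩ := DoubleCoset.mem_doubleCoset.1 h
    exact mul_mem_cell hx hy' ⟨m * n, rfl, a, ha, b, hb, h⟩
  · obtain ⟨a, ha, b, hb, h⟩ := DoubleCoset.mem_doubleCoset.1 h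
    exact mul_mem_cell hx hy' ⟨n, rfl, a, ha, b, hb, h⟩

theorem inv_of_mem_S {s : P.W} (hs : s ∈ P.S) : s⁻¹ = s :=
  inv_eq_of_mul_eq_one_left (P.sq_S s hs)

theorem mul_self_mul {s : P.W} (hs : s ∈ P.S) (w : P.W) : s * (s * w) = w := by
  rw [← mul_assoc, P.sq_S s hs, one_mul]

theorem mul_mem_cell_or' {s w : P.W} (hs : s ∈ P.S) {g h : G} (hg : g ∈ P.cell w)
    (hh : h ∈ P.cell s) : g * h ∈ P.cell (w * s) ∨ g * h ∈ P.cell w := by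
  have hh' := inv_mem_cell hh
  rw [inv_of_mem_S hs] at hh'
  refine (mul_mem_cell_or hs hh' (inv_mem_cell hg)).imp (fun h => ?_) (fun h => ?_)
  · simpa [inv_of_mem_S hs] using inv_mem_cell h
  · simpa using inv_mem_cell h

/-! ### Words and length -/

theorem exists_word (w : P.W) : ∃ l : List P.W, (∀ s ∈ l, s ∈ P.S) ∧ l.prod = w := by
  have hw : w ∈ Subgroup.closure P.S := by rw [P.closure_S]; trivial
  induction hw using Subgroup.closure_induction_left with
  | one => exact ⟨[], by simp, rfl⟩
  | mul_left x hx y _ ih =>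
    obtain ⟨l, hl, rfl⟩ := ih
    exact ⟨x :: l, by simpa [hx] using hl, by simp⟩
  | inv_mul_cancel x hx y _ ih =>
    obtain ⟨l, hl, rfl⟩ := ih
    exact ⟨x :: l, by simpa [hx] using hl, by simp [inv_of_mem_S hx]⟩

theorem exists_reduced_word (w : P.W) :
    ∃ l : List P.W, (∀ s ∈ l, s ∈ P.S) ∧ l.prod = w ∧ l.length = P.length w := by
  obtain ⟨l, hl, hw⟩ := exists_word w
  exact Nat.sInf_mem (s := {m : ℕ | ∃ l : List P.W, (∀ s ∈ l, s ∈ P.S) ∧ l.prod = w ∧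
    l.length = m}) ⟨l.length, l, hl, hw, rfl⟩

theorem length_prod_le {l : List P.W} (hl : ∀ s ∈ l, s ∈ P.S) :
    P.length l.prod ≤ l.length :=
  Nat.sInf_le ⟨l, hl, rfl, rfl⟩

theorem length_mul_le (w w' : P.W) : P.length (w * w') ≤ P.length w + P.length w' := by
  obtain ⟨l, hl, rfl, h⟩ := exists_reduced_word w
  obtain ⟨l', hl', rfl, h'⟩ := exists_reduced_word w'
  rw [← h, ← h', ← List.prod_append, ← List.length_append]
  exact length_prod_le (by simpa [or_imp, forall_and] using ⟨hl, hl'⟩)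

theorem length_le_one {s : P.W} (hs : s ∈ P.S) : P.length s ≤ 1 := by
  simpa using length_prod_le (P := P) (l := [s]) (by simpa using hs)

theorem length_one : P.length (1 : P.W) = 0 := by
  simpa using length_prod_le (P := P) (l := []) (by simp)

theorem length_eq_zero_iff {w : P.W} : P.length w = 0 ↔ w = 1 := by
  refine ⟨fun h => ?_, fun h => h ▸ length_one⟩
  obtain ⟨l, -, rfl, hl⟩ := exists_reduced_word w
  rw [h, List.length_eq_zero_iff] at hl
  simp [hl]

theorem length_inv_le (w : P.W) : P.length w⁻¹ ≤ P.length w := by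
  obtain ⟨l, hl, rfl, h⟩ := exists_reduced_word w
  rw [← h, List.prod_inv_reverse]
  have e : l.map (·⁻¹) = l := by
    conv_rhs => rw [← List.map_id l]
    exact List.map_congr_left fun s hs => inv_of_mem_S (hl s hs)
  rw [e, ← l.length_reverse]
  exact length_prod_le (by simpa using hl)

theorem length_inv (w : P.W) : P.length w⁻¹ = P.length w :=
  (length_inv_le w).antisymm (by simpa using length_inv_le w⁻¹)

theorem exists_mul_of_length_eq_succ {w : P.W} {r : ℕ} (h : P.length w = r + 1) :
    ∃ s ∈ P.S, ∃ v, w = s * v ∧ P.length v = r := by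
  obtain ⟨l, hl, rfl, hw⟩ := exists_reduced_word w
  match l with
  | [] => simp [length_one] at h
  | s :: t =>
    simp only [List.mem_cons, forall_eq_or_imp] at hl
    refine ⟨s, hl.1, t.prod, by simp, ?_⟩
    have h1 := length_prod_le hl.2
    have h2 := length_mul_le s t.prod
    have h3 := length_le_one hl.1
    simp only [List.prod_cons, List.length_cons] at h hw
    omega

/-! ### The Bruhat decomposition -/

theorem eq_of_mem_cell {w w' : P.W} {g : G} (hg : g ∈ P.cell w) (hg' : g ∈ P.cell w') :
    w = w' := by
  suffices H : ∀ (r : ℕ) (w w' : P.W), P.length w = r → r ≤ P.length w' →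
      ∀ g, g ∈ P.cell w → g ∈ P.cell w' → w = w' by
    rcases le_total (P.length w) (P.length w') with h | h
    · exact H _ _ _ rfl h g hg hg'
    · exact (H _ _ _ rfl h g hg' hg).symm
  clear hg hg' g w w'
  intro r
  induction r with
  | zero =>
    intro w w' hw _ g hg hg'
    rw [length_eq_zero_iff] at hw
    subst hw
    rw [cell_one, SetLike.mem_coe] at hg
    obtain ⟨n, rfl, x, hx, y, hy, rfl⟩ := hg'
    rw [← QuotientGroup.mk_one, coe_eq_coe_iff]
    simpa [mul_mem_cancel_left hx, mul_mem_cancel_right hy] using hg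
  | succ r ih =>
    intro w w' hw hw' g hg hg'
    obtain ⟨s, hs, v, rfl, hv⟩ := exists_mul_of_length_eq_succ hw
    obtain ⟨m, rfl⟩ := QuotientGroup.mk_surjective s
    obtain ⟨n, rfl⟩ := QuotientGroup.mk_surjective v
    rw [← QuotientGroup.mk_mul, mem_cell_iff] at hg
    obtain ⟨x, hx, y, hy, rfl⟩ := hg
    have h1 : (m : G) * n ∈ P.cell w' := by
      simpa [mul_assoc] using mul_mem_cell (inv_mem hx) (inv_mem hy) hg'
    have h2 : (m : G)⁻¹ ∈ P.cell (m : P.W) := by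
      simpa [inv_of_mem_S hs] using inv_mem_cell (coe_mem_cell m)
    have h3 := mul_mem_cell_or hs h2 h1
    rw [inv_mul_cancel_left] at h3
    have h4 := length_mul_le (m : P.W) ((m : P.W) * w')
    rw [mul_self_mul hs] at h4
    have h5 := length_le_one hs
    -- Induction gives `v = s w'`, as wanted, or `v = w'`, which is impossible since `l(w') > r =
    -- l(v)`.
    rcases h3 with h3 | h3
    · rw [ih _ _ hv (by omega) _ (coe_mem_cell n) h3, mul_self_mul hs]
    · have := ih _ _ hv (by omega) _ (coe_mem_cell n) h3
      rw [← this] at hw'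
      omega

theorem exists_mem_cell (g : G) : ∃ w, g ∈ P.cell w := by
  have hg : g ∈ Subgroup.closure ((P.B : Set G) ∪ P.N) := by
    rw [Subgroup.closure_union, Subgroup.closure_eq, Subgroup.closure_eq, P.sup_eq_top]
    trivial
  -- The union of the cells is closed under products: peel off the letters of a word for `v` one at
  -- a time.
  have hW (v w : P.W) (g h : G) (hg : g ∈ P.cell v) (hh : h ∈ P.cell w) :
      ∃ w', g * h ∈ P.cell w' := by
    obtain ⟨l, hl, rfl⟩ := exists_word v
    induction l generalizing g h w with
    | nil =>
      rw [List.prod_nil, cell_one] at hg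
      exact ⟨w, by simpa using mul_mem_cell hg (one_mem _) hh⟩
    | cons s t ih =>
      simp only [List.mem_cons, forall_eq_or_imp] at hl
      obtain ⟨m, rfl⟩ := QuotientGroup.mk_surjective s
      obtain ⟨n, hn⟩ := QuotientGroup.mk_surjective t.prod
      rw [List.prod_cons, ← hn, ← QuotientGroup.mk_mul, mem_cell_iff] at hg
      obtain ⟨x, hx, y, hy, rfl⟩ := hg
      have hn' : (n : G) * y ∈ P.cell t.prod := by
        rw [← hn]
        simpa using mul_mem_cell (one_mem _) hy (coe_mem_cell n)
      obtain ⟨w', hw'⟩ := ih w (n * y) h hh hl.2 hn'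
      have e : x * ((m * n : P.N) : G) * y * h = x * m * (n * y * h) := by
        simp [mul_assoc]
      rw [e]
      have hm : x * m ∈ P.cell (m : P.W) := by
        simpa using mul_mem_cell hx (one_mem _) (coe_mem_cell m)
      rcases mul_mem_cell_or hl.1 hm hw' with h | h
      exacts [⟨_, h⟩, ⟨_, h⟩]
  induction hg using Subgroup.closure_induction with
  | mem x hx =>
    rcases hx with hx | hx
    · exact ⟨1, by rwa [cell_one]⟩
    · exact ⟨_, coe_mem_cell ⟨x, hx⟩⟩
  | one => exact ⟨1, by rw [cell_one]; exact one_mem _⟩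
  | mul x y _ _ hx hy =>
    obtain ⟨v, hv⟩ := hx
    obtain ⟨w, hw⟩ := hy
    exact hW v w x y hv hw
  | inv x _ hx =>
    obtain ⟨v, hv⟩ := hx
    exact ⟨_, inv_mem_cell hv⟩

/-! ### The exchange condition -/

/-- `BsB ⬝ BwB` is the single double coset `BswB`. -/
def Adds (s w : P.W) : Prop :=
  ∀ g ∈ P.cell s, ∀ h ∈ P.cell w, g * h ∈ P.cell (s * w)

theorem adds_one (s : P.W) : Adds s 1 := by
  intro g hg h hh
  rw [cell_one] at hh
  simpa using mul_mem_cell (one_mem _) hh hg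

theorem ne_one_of_mem_S {s : P.W} (hs : s ∈ P.S) : s ≠ 1 := by
  rintro rfl
  refine P.conj_ne 1 (by simpa using hs) ?_
  simp

theorem exists_conj_not_mem {n : P.N} (hn : (n : P.W) ∈ P.S) :
    ∃ b ∈ P.B, (n : G) * b * n ∉ P.B := by
  by_contra! H
  refine P.conj_ne n hn (Set.Subset.antisymm ?_ ?_)
  · rintro _ ⟨b, hb, rfl⟩
    exact H b hb
  · intro b hb
    have hsq : (n : G) * n ∈ P.B := by
      have := P.sq_S _ hn
      rw [← QuotientGroup.mk_mul, ← QuotientGroup.mk_one, eq_comm, coe_eq_coe_iff] at this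
      simpa using this
    refine ⟨(n : G)⁻¹ * b * (n : G)⁻¹, ?_, by group⟩
    have e : (n : G)⁻¹ * b * (n : G)⁻¹ = (n * n : G)⁻¹ * (n * b * n) * (n * n : G)⁻¹ := by group
    rw [e]
    exact mul_mem (mul_mem (inv_mem hsq) (H b hb)) (inv_mem hsq)

/-- Since `n b n ∉ B` for some `b ∈ B`, the element `n b n` lies in `BsB`. Under both hypotheses `n
b n m` would lie in `BswB` and in `BwB`, forcing `s = 1`. -/
theorem not_adds_mul {s w : P.W} (hs : s ∈ P.S) (h : Adds s w) : ¬ Adds s (s * w) := by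
  intro h'
  obtain ⟨n, rfl⟩ := QuotientGroup.mk_surjective s
  obtain ⟨m, rfl⟩ := QuotientGroup.mk_surjective w
  obtain ⟨b, hb, hnb⟩ := exists_conj_not_mem hs
  have hn := coe_mem_cell n
  have hbn : b * n ∈ P.cell (n : P.W) := by simpa using mul_mem_cell hb (one_mem _) hn
  have h1 : (n : G) * (b * n) ∈ P.cell (n : P.W) := by
    refine (mul_mem_cell_or hs hn hbn).resolve_left fun h => hnb ?_
    rwa [P.sq_S _ hs, cell_one, ← mul_assoc] at h
  have h2 := h _ h1 _ (coe_mem_cell m)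
  have h3 := h' _ hn _ (h _ hbn _ (coe_mem_cell m))
  rw [mul_self_mul hs, ← mul_assoc] at h3
  exact ne_one_of_mem_S hs (by simpa using eq_of_mem_cell h2 h3)

/-- Some element of `BsB ⬝ BwtB` lies in `BwtB`. Multiplying it on the right by a suitable element
of `BtB` lands in `BswB` and in `BwB ∪ BwtB`; the cell `BwB` is excluded as `s ≠ 1`. -/
theorem mul_eq_mul_of_not_adds {s t w : P.W} (hs : s ∈ P.S) (ht : t ∈ P.S) (h : Adds s w)
    (h' : ¬ Adds s (w * t)) : s * w = w * t := by
  simp only [Adds, not_forall] at h'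
  obtain ⟨g, hg, x, hx, hgx⟩ := h'
  have h1 := (mul_mem_cell_or hs hg hx).resolve_left hgx
  obtain ⟨n, rfl⟩ := QuotientGroup.mk_surjective w
  obtain ⟨m, rfl⟩ := QuotientGroup.mk_surjective t
  rw [← QuotientGroup.mk_mul, mem_cell_iff] at hx
  obtain ⟨a, ha, b, hb, rfl⟩ := hx
  have hm : b⁻¹ * (m : G)⁻¹ ∈ P.cell (m : P.W) := by
    have := inv_mem_cell (coe_mem_cell m)
    rw [inv_of_mem_S ht] at this
    simpa using mul_mem_cell (inv_mem hb) (one_mem _) this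
  have h2 := mul_mem_cell_or' ht h1 hm
  have e : g * (a * ((n * m : P.N) : G) * b) * (b⁻¹ * (m : G)⁻¹) = g * (a * n) := by
    simp [mul_assoc]
  rw [e, mul_assoc, P.sq_S _ ht, mul_one] at h2
  have h3 := h _ hg _ (by simpa using mul_mem_cell ha (one_mem _) (coe_mem_cell n))
  rcases h2 with h2 | h2
  · exact absurd (by simpa using eq_of_mem_cell h3 h2) (ne_one_of_mem_S hs)
  · exact eq_of_mem_cell h3 h2

/-- The letter to delete is the first one at which additivity with `s` fails. The prefix `x` is
protected from deletion, which the study of the longest element needs. -/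
theorem exchange {s x : P.W} (hs : s ∈ P.S) {l : List P.W} (hl : ∀ t ∈ l, t ∈ P.S)
    (hx : Adds s x) (h : ¬ Adds s (x * l.prod)) :
    ∃ l' : List P.W, (∀ t ∈ l', t ∈ P.S) ∧ l'.length + 1 = l.length ∧
      s * (x * l.prod) = x * l'.prod := by
  induction l using List.reverseRecOn with
  | nil => simp [hx] at h
  | append_singleton l a ih =>
    simp only [List.mem_append, List.mem_singleton, or_imp, forall_and, forall_eq] at hl
    by_cases h' : Adds s (x * l.prod)
    · have := mul_eq_mul_of_not_adds hs hl.2 h' (by simpa [mul_assoc] using h)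
      refine ⟨l, hl.1, by simp, ?_⟩
      rw [List.prod_append, List.prod_singleton, ← mul_assoc x, ← mul_assoc s, this, mul_assoc,
        P.sq_S _ hl.2, mul_one]
    · obtain ⟨l', hl', h1, h2⟩ := ih hl.1 h'
      refine ⟨l' ++ [a], by simpa [or_imp, forall_and, hl.2] using hl', by simpa using h1, ?_⟩
      simp only [List.prod_append, List.prod_singleton, ← mul_assoc] at h2 ⊢
      rw [h2]

theorem length_mul_lt_of_not_adds {s w : P.W} (hs : s ∈ P.S) (h : ¬ Adds s w) :
    P.length (s * w) < P.length w := by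
  obtain ⟨l, hl, rfl, hw⟩ := exists_reduced_word w
  obtain ⟨l', hl', h1, h2⟩ := exchange hs hl (adds_one s) (by simpa using h)
  rw [one_mul, one_mul] at h2
  have := length_prod_le hl'
  rw [h2]
  omega

theorem adds_iff {s w : P.W} (hs : s ∈ P.S) : Adds s w ↔ P.length w < P.length (s * w) := by
  constructor
  · intro h
    simpa [mul_self_mul hs] using length_mul_lt_of_not_adds hs (not_adds_mul hs h)
  · intro h
    by_contra h'
    exact absurd (length_mul_lt_of_not_adds hs h') (by omega)

/-! ### The longest element -/

/-- Local maximality suffices: every reduced word is the beginning of a reduced word for `w`. To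
prepend `s` to such a beginning, exchange it for a letter in the remainder. -/
theorem length_mul_add_of_forall {w : P.W} (hw : ∀ s ∈ P.S, P.length (s * w) ≤ P.length w)
    (u : P.W) : P.length (u * w) + P.length u = P.length w := by
  have key (t : List P.W) (ht : ∀ s ∈ t, s ∈ P.S) (htl : P.length t.prod = t.length) :
      ∃ v : List P.W, (∀ s ∈ v, s ∈ P.S) ∧ w = t.prod * v.prod ∧
        t.length + v.length = P.length w := by
    induction t with
    | nil =>
      obtain ⟨l, hl, h, h'⟩ := exists_reduced_word w
      exact ⟨l, hl, by simp [h], by simpa using h'⟩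
    | cons s t ih =>
      simp only [List.mem_cons, forall_eq_or_imp] at ht
      rw [List.prod_cons, List.length_cons] at htl
      have h1 := length_prod_le ht.2
      have h2 := length_mul_le s t.prod
      have h3 := length_le_one ht.1
      obtain ⟨v, hv, hwv, hlen⟩ := ih ht.2 (by omega)
      obtain ⟨v', hv', h4, h5⟩ := exchange ht.1 hv ((adds_iff ht.1 (w := t.prod)).2 (by omega))
        (by rw [← hwv, adds_iff ht.1]; exact not_lt.2 (hw s ht.1))
      refine ⟨v', hv', ?_, by simp only [List.length_cons]; omega⟩
      rw [List.prod_cons, mul_assoc, ← h5, ← hwv, mul_self_mul ht.1]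
  -- With `u⁻¹` as the beginning, the remainder is a word for `u w`.
  obtain ⟨t, ht, h1, h2⟩ := exists_reduced_word u⁻¹
  obtain ⟨v, hv, h3, h4⟩ := key t ht (by rw [h1, h2])
  rw [h1] at h3
  have h5 : u * w = v.prod := by rw [h3, mul_inv_cancel_left]
  have h6 := length_prod_le hv
  have h7 := length_mul_le u⁻¹ (u * w)
  rw [inv_mul_cancel_left] at h7
  rw [length_inv] at h2 h7
  rw [h5] at h7 ⊢
  omega

theorem eq_longest_of_forall {n₀ : P.N} (hn₀ : P.RepresentsLongest n₀) {w : P.W}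
    (hw : ∀ s ∈ P.S, P.length (s * w) ≤ P.length w) : w = n₀ := by
  have h := length_mul_add_of_forall hw ((n₀ : P.W) * w⁻¹)
  rw [inv_mul_cancel_right] at h
  have h' := hn₀ w
  have h'' := length_eq_zero_iff.1 (show P.length ((n₀ : P.W) * w⁻¹) = 0 by omega)
  exact (mul_inv_eq_one.1 h'').symm

theorem length_longest_mul {n₀ : P.N} (hn₀ : P.RepresentsLongest n₀) (u : P.W) :
    P.length ((n₀ : P.W) * u) + P.length u = P.length (n₀ : P.W) := by
  have h := length_mul_add_of_forall (w := (n₀ : P.W)⁻¹)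
    (fun s _ => by simpa [length_inv] using hn₀ _) u⁻¹
  rwa [← mul_inv_rev, length_inv, length_inv, length_inv] at h

/-! ### Intersections of conjugates of `B` -/

/-- The element `y = n⁻¹ b n` lies in `m B m⁻¹ ⊆ B ∪ BmB`. If `y ∈ BmB`, additivity puts `n y` in
`BnmB`, whereas `n y = b n ∈ BnB`. -/
theorem conj_mem_of_conj_mul_mem_of_mem_S {n m : P.N} (hm : (m : P.W) ∈ P.S)
    (h : P.length (n : P.W) < P.length ((n : P.W) * m)) {b : G} (hb : b ∈ P.B)
    (hnm : ((n : G) * m)⁻¹ * b * (n * m) ∈ P.B) : (n : G)⁻¹ * b * n ∈ P.B := by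
  have hadd : Adds (m : P.W) (n : P.W)⁻¹ := by
    rw [adds_iff hm, length_inv]
    have := length_inv ((n : P.W) * (m : P.W))
    rw [mul_inv_rev, inv_of_mem_S hm] at this
    rwa [this]
  set y := (n : G)⁻¹ * b * n with hy
  have hym : y = m * (((n : G) * m)⁻¹ * b * (n * m)) * (m : G)⁻¹ := by rw [hy]; group
  have hmi : (m : G)⁻¹ ∈ P.cell (m : P.W) := by
    simpa [inv_of_mem_S hm] using inv_mem_cell (coe_mem_cell m)
  have h1 : y ∈ P.cell 1 ∨ y ∈ P.cell (m : P.W) := by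
    have := mul_mem_cell_or hm (mul_mem_cell (one_mem _) hnm (coe_mem_cell m)) hmi
    rwa [P.sq_S _ hm, one_mul, ← hym] at this
  rcases h1 with h1 | h1
  · rwa [cell_one] at h1
  · have h2 := inv_mem_cell h1
    rw [inv_of_mem_S hm] at h2
    have h3 := inv_mem_cell (hadd _ h2 _ (inv_mem_cell (coe_mem_cell n)))
    have h4 : (n : G) * y ∈ P.cell ((n : P.W) * m) := by
      simpa [inv_of_mem_S hm] using h3
    have h5 : (n : G) * y ∈ P.cell (n : P.W) := by
      rw [hy, show (n : G) * ((n : G)⁻¹ * b * n) = b * n by group]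
      simpa using mul_mem_cell hb (one_mem _) (coe_mem_cell n)
    have h6 := eq_of_mem_cell h5 h4
    rw [← h6] at h
    omega

theorem conj_mem_congr {n n' : P.N} (h : (n : P.W) = n') {b : G} :
    (n : G)⁻¹ * b * n ∈ P.B ↔ (n' : G)⁻¹ * b * n' ∈ P.B := by
  have h' := coe_eq_coe_iff.1 h
  have e : (n : G)⁻¹ * b * n = ((n : G)⁻¹ * n') * ((n' : G)⁻¹ * b * n') * ((n : G)⁻¹ * n')⁻¹ := by
    group
  rw [e, mul_mem_cancel_right (inv_mem h'), mul_mem_cancel_left h']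

theorem conj_mem_of_conj_mul_mem {n m : P.N}
    (h : P.length ((n : P.W) * m) = P.length (n : P.W) + P.length (m : P.W)) {b : G}
    (hb : b ∈ P.B) (hnm : ((n : G) * m)⁻¹ * b * (n * m) ∈ P.B) : (n : G)⁻¹ * b * n ∈ P.B := by
  induction hr : P.length (m : P.W) generalizing m n with
  | zero =>
    rw [length_eq_zero_iff] at hr
    exact (conj_mem_congr (n := n * m) (by simp [hr])).1 (by simpa using hnm)
  | succ r ih =>
    obtain ⟨s, hs, v, hv, hvl⟩ := exists_mul_of_length_eq_succ hr
    obtain ⟨m₁, rfl⟩ := QuotientGroup.mk_surjective s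
    obtain ⟨m₂, rfl⟩ := QuotientGroup.mk_surjective v
    have h1 := length_mul_le ((n : P.W) * (m₁ : P.W)) (m₂ : P.W)
    have h2 := length_mul_le (n : P.W) (m₁ : P.W)
    have h3 := length_le_one hs
    rw [hv, ← mul_assoc] at h
    have h4 := hr
    rw [hv] at h4
    have := ih (n := n * m₁) (m := m₂) (by rw [QuotientGroup.mk_mul]; omega)
      (by simpa [mul_assoc] using (conj_mem_congr (n := n * m) (n' := n * m₁ * m₂)
        (by simp [hv, mul_assoc])).1 (by simpa using hnm)) hvl
    exact conj_mem_of_conj_mul_mem_of_mem_S hs (by omega) hb (by simpa using this)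

/-- Lengths add in `n₀ = n (n⁻¹ n₀)` for every `n`, so `b` lies in every `n B n⁻¹`; their
intersection is `H`. -/
theorem mem_inf_of_conj_longest_mem {n₀ : P.N} (hn₀ : P.RepresentsLongest n₀) {b : G}
    (hb : b ∈ P.B) (h : (n₀ : G)⁻¹ * b * n₀ ∈ P.B) : b ∈ P.B ⊓ P.N := by
  rw [← P.iInf_conj, Subgroup.mem_iInf]
  intro n
  have hlen := length_mul_add_of_forall (w := (n₀ : P.W)) (fun s _ => hn₀ _) (n : P.W)⁻¹
  rw [length_inv] at hlen
  have := conj_mem_of_conj_mul_mem (n := n) (m := n⁻¹ * n₀)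
    (by simpa [add_comm] using hlen.symm) hb (by simpa using h)
  exact ⟨_, this, by simp [mul_assoc]⟩

theorem eq_one_of_conj_longest_mem {n₀ : P.N} (hn₀ : P.RepresentsLongest n₀) {x : G}
    (hx : x ∈ P.U) (h : (n₀ : G)⁻¹ * x * n₀ ∈ P.B) : x = 1 := by
  rw [← Subgroup.mem_bot, ← P.U_inf_H]
  exact ⟨hx, mem_inf_of_conj_longest_mem hn₀ (P.U_le_B hx) h⟩

theorem conj_mem_of_mem_rootSubgroup {n₀ : P.N} (hn₀ : P.RepresentsLongest n₀) {n m : P.N}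
    (hm : (m : P.W) ∈ P.S) (h : P.length (n : P.W) < P.length ((m : P.W) * n)) {x : G}
    (hx : x ∈ P.rootSubgroup n₀ m) : (n : G)⁻¹ * x * n ∈ P.B := by
  obtain ⟨hxU, _, ⟨z, hz, rfl⟩, hzx⟩ := hx
  have hzx' : x = (m : G)⁻¹ * ((n₀ : G)⁻¹ * z * n₀) * m := by
    simpa using hzx.symm
  have h1 := length_longest_mul hn₀ (m : P.W)
  have h2 := length_longest_mul hn₀ ((m : P.W) * n)
  have h3 := length_mul_le (m : P.W) n
  have h4 := length_le_one hm
  have h5 := length_eq_zero_iff.not.2 (ne_one_of_mem_S hm)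
  -- Lengths add in `n₀ m = (n₀ m n) n⁻¹`, because `l(n₀ m n) = l(n₀) - l(n) - 1`. Conjugating `z`
  -- by `n₀ m` gives `x ∈ B`, so conjugating it by `n₀ m n`, which gives `n⁻¹ x n`, also stays in
  -- `B`.
  have := conj_mem_of_conj_mul_mem (n := n₀ * m * n) (m := n⁻¹) (b := z)
    (by
      simp only [QuotientGroup.mk_mul, QuotientGroup.mk_inv, mul_inv_cancel_right, length_inv]
      rw [mul_assoc]
      omega)
    (P.U_le_B hz) (by simpa [hzx', mul_assoc] using P.U_le_B hxU)
  simpa [hzx', mul_assoc] using this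

theorem exists_rootSubgroup_conj {n₀ : P.N} (hn₀ : P.RepresentsLongest n₀) {n : P.N}
    (hn : (n : P.W) ≠ n₀) :
    ∃ m : P.N, (m : P.W) ∈ P.S ∧ ∀ x ∈ P.rootSubgroup n₀ m, (n : G)⁻¹ * x * n ∈ P.B := by
  by_contra! H
  refine hn (eq_longest_of_forall hn₀ fun s hs => ?_)
  obtain ⟨m, rfl⟩ := QuotientGroup.mk_surjective s
  obtain ⟨x, hx, hx'⟩ := H m hs
  by_contra! hlt
  exact hx' (conj_mem_of_mem_rootSubgroup hn₀ hs hlt hx)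

theorem exists_mul_eq (g : G) : ∃ x ∈ P.U, ∃ n : P.N, ∃ b ∈ P.B, g = x * n * b := by
  obtain ⟨w, n, rfl, b, hb, c, hc, rfl⟩ := exists_mem_cell (P := P) g
  rw [← P.U_sup_H, ← SetLike.mem_coe, Subgroup.coe_mul_of_right_le_normalizer_left] at hb
  · obtain ⟨x, hx, h, hh, rfl⟩ := hb
    exact ⟨x, hx, ⟨h, hh.2⟩ * n, c, hc, by simp [mul_assoc]⟩
  · exact inf_le_left.trans ((Subgroup.normal_subgroupOf_iff_le_normalizer P.U_le_B).1 P.normal_U)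

end Bruhat

end SplitBNPair

/-! ### Module theory: multiplicities, base change and pairings. -/

/-- The image of `j` enters a composition series at exactly one step. There `N` maps non-trivially
onto the simple factor, with kernel its only maximal submodule `K`. All other factors are killed by
`a`, which acts non-trivially on `N ⧸ K`. -/
theorem occursWithMultiplicity_one {R M N : Type*} [Ring R] [AddCommGroup M] [Module R M]
    [AddCommGroup N] [Module R N] [IsNoetherian R M] [IsArtinian R M] {K : Submodule R N}
    (hK : ∀ X : Submodule R N, IsCoatom X ↔ X = K) (j : N →ₗ[R] M) (hj : j ≠ 0) (a : R)
    (ha : ∀ x : M, a • x ∈ LinearMap.range j)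
    (hX : ∀ X : Submodule R M, LinearMap.range j ≤ X ∨ ∀ x ∈ X, a • x = 0)
    (hD : ∃ x : N ⧸ K, a • x ≠ 0) : OccursWithMultiplicity R M (N ⧸ K) 1 := by
  refine ⟨exists_compositionSeries_of_isNoetherian_isArtinian R M, fun s h0 h1 => ?_⟩
  have hlast : s (Fin.last s.length) = ⊤ := h1
  have hfirst : s 0 = ⊥ := h0
  have hfactor (X Y : Submodule R M) (hXY : X ⋖ Y) (hle : LinearMap.range j ≤ Y)
      (hnle : ¬ LinearMap.range j ≤ X) : Nonempty ((↥Y ⧸ X.submoduleOf Y) ≃ₗ[R] (N ⧸ K)) := by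
    have : IsSimpleModule R (↥Y ⧸ X.submoduleOf Y) := (covBy_iff_quot_is_simple hXY.le).1 hXY
    let g : N →ₗ[R] (↥Y ⧸ X.submoduleOf Y) :=
      (X.submoduleOf Y).mkQ ∘ₗ j.codRestrict Y fun x => hle ⟨x, rfl⟩
    have hg : g ≠ 0 := by
      intro hg
      refine hnle ?_
      rintro _ ⟨x, rfl⟩
      have := LinearMap.congr_fun hg x
      rwa [LinearMap.comp_apply, LinearMap.zero_apply, Submodule.mkQ_apply,
        Submodule.Quotient.mk_eq_zero] at this
    have hsurj := LinearMap.surjective_of_ne_zero hg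
    have hker : LinearMap.ker g = K := by
      rw [← hK, ← isSimpleModule_iff_isCoatom]
      exact IsSimpleModule.congr (g.quotKerEquivOfSurjective hsurj)
    exact ⟨(g.quotKerEquivOfSurjective hsurj).symm ≪≫ₗ Submodule.quotEquivOfEq _ _ hker⟩
  have hzero (X Y : Submodule R M) (hle : ∀ y ∈ Y, a • y ∈ X) :
      IsEmpty ((↥Y ⧸ X.submoduleOf Y) ≃ₗ[R] (N ⧸ K)) := by
    refine ⟨fun e => ?_⟩
    obtain ⟨x, hx⟩ := hD
    refine hx ?_
    obtain ⟨y, rfl⟩ := e.surjective x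
    obtain ⟨y, rfl⟩ := Submodule.mkQ_surjective _ y
    rw [← map_smul, ← map_smul, LinearEquiv.map_eq_zero_iff, Submodule.mkQ_apply,
      Submodule.Quotient.mk_eq_zero]
    exact hle y y.2
  obtain ⟨i, hle, hnle⟩ : ∃ i : Fin s.length,
      LinearMap.range j ≤ s i.succ ∧ ¬ LinearMap.range j ≤ s i.castSucc := by
    by_contra! H
    have hall (i : Fin (s.length + 1)) : ¬ LinearMap.range j ≤ s i := by
      induction i using Fin.induction with
      | zero =>
        rw [hfirst, le_bot_iff, LinearMap.range_eq_bot]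
        exact hj
      | succ i ih => exact fun h => ih (H i h)
    exact hall (Fin.last _) (hlast ▸ le_top)
  have huniq (i' : Fin s.length) :
      Nonempty ((↥(s i'.succ) ⧸ (s i'.castSucc).submoduleOf (s i'.succ)) ≃ₗ[R] (N ⧸ K)) ↔
        i' = i := by
    refine ⟨fun h => ?_, fun h => h ▸ hfactor _ _ (s.step i) hle hnle⟩
    by_contra hne
    refine not_isEmpty_iff.2 h (hzero _ _ fun y hy => ?_)
    -- Before step `i` the upper term does not contain the image of `j`, so `a` kills it; after step
    -- `i` the lower term contains the image of `j`, hence all of `a M`.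
    rcases lt_or_gt_of_ne hne with hlt | hlt
    · have hmono : s i'.succ ≤ s i.castSucc := s.strictMono.monotone (by
        rw [Fin.le_iff_val_le_val]; simpa using hlt)
      rw [(hX _).resolve_left (fun h => hnle (h.trans hmono)) y hy]
      exact zero_mem _
    · exact hle.trans (s.strictMono.monotone (by
        rw [Fin.le_iff_val_le_val]; simpa using hlt)) (ha y)
  rw [Nat.card_eq_one_iff_unique]
  exact ⟨⟨fun x y => Subtype.ext (((huniq _).1 x.2).trans ((huniq _).1 y.2).symm)⟩,
    ⟨⟨i, (huniq i).2 rfl⟩⟩⟩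

-- The functionals embed `V` in `k^ι`, and tensoring with `L` preserves this injection.
open TensorProduct in
theorem LinearMap.eq_zero_of_forall_baseChange {k L V ι : Type*} [Field k] [Field L] [Algebra k L]
    [AddCommGroup V] [Module k V] [Finite ι] (f : ι → V →ₗ[k] k)
    (hf : ∀ x, (∀ i, f i x = 0) → x = 0) {x : L ⊗[k] V} (hx : ∀ i, (f i).baseChange L x = 0) :
    x = 0 := by
  classical
  have := Fintype.ofFinite ι
  have hinj : Function.Injective (LinearMap.pi f) := by
    rw [injective_iff_map_eq_zero]
    exact fun x hx => hf x fun i => congrFun hx i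
  have hinj' := Module.Flat.lTensor_preserves_injective_linearMap (M := L) _ hinj
  refine hinj' ((TensorProduct.piRight k k L (fun _ : ι => k)).injective ?_)
  rw [map_zero, map_zero]
  ext i
  rw [Pi.zero_apply, ← hx i]
  clear hx
  induction x with
  | zero => simp
  | add x y hx hy => simp only [map_add, Pi.add_apply, hx, hy]
  | tmul l v => simp

-- After base change `a` still acts as `x ↦ φ_L(x) (1 ⊗ e)`. A subrepresentation on which `φ_L` is
-- not identically zero contains `1 ⊗ e`, which generates; any other is killed by all `φ_L ∘ g`,
-- hence zero.
open TensorProduct in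
theorem Representation.isIrreducible_scalarExt {k G V : Type*} [Field k] [Group G] [Finite G]
    [AddCommGroup V] [Module k V] (ρ : Representation k G V) (a : MonoidAlgebra k G) (e : V)
    (φ : V →ₗ[k] k) (ha : ∀ x, ρ.asAlgebraHom a x = φ x • e) (he : e ≠ 0)
    (hspan : ∀ X : Submodule k V, (∀ g, ∀ x ∈ X, ρ g x ∈ X) → e ∈ X → X = ⊤)
    (hφ : ∀ x, (∀ g, φ (ρ g x) = 0) → x = 0) (L : Type*) [Field L] [Algebra k L] :
    (ρ.scalarExt L).IsIrreducible := by
  have hact (g : G) : ρ.scalarExt L g = (ρ g).baseChange L := rfl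
  have hne : (1 : L) ⊗ₜ[k] e ≠ 0 := fun h => he <| by
    have hinj := Module.Flat.rTensor_preserves_injective_linearMap (M := V)
      (Algebra.linearMap k L) (algebraMap k L).injective
    have := @hinj (1 ⊗ₜ e) 0 (by simpa using h)
    simpa using congrArg (_root_.TensorProduct.lid k V) this
  let φL : L ⊗[k] V →ₗ[L] L :=
    (_root_.TensorProduct.AlgebraTensorModule.rid k L L).toLinearMap ∘ₗ φ.baseChange L
  have hφL (x : L ⊗[k] V) :
      (ρ.asAlgebraHom a).baseChange L x = φL x • (1 : L) ⊗ₜ[k] e := by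
    induction x with
    | zero => simp
    | add x y hx hy => simp only [map_add, add_smul, hx, hy]
    | tmul l v =>
      simp [φL, ha, _root_.TensorProduct.smul_tmul', _root_.TensorProduct.tmul_smul]
  have hstable (X : Subrepresentation (ρ.scalarExt L)) (b : MonoidAlgebra k G) {x : L ⊗[k] V}
      (hx : x ∈ X) : (ρ.asAlgebraHom b).baseChange L x ∈ X.toSubmodule := by
    induction b using MonoidAlgebra.induction_on with
    | of g =>
      rw [asAlgebraHom_of]
      exact X.apply_mem_toSubmodule g hx
    | add b c hb hc =>
      rw [map_add, LinearMap.baseChange_add, LinearMap.add_apply]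
      exact add_mem hb hc
    | smul r b hb =>
      rw [map_smul, LinearMap.baseChange_smul, LinearMap.smul_apply, ← algebraMap_smul L r]
      exact X.toSubmodule.smul_mem _ hb
  refine { exists_pair_ne := ⟨⊥, ⊤, fun h => hne ?_⟩, eq_bot_or_eq_top := fun X => ?_ }
  · have : (1 : L) ⊗ₜ[k] e ∈ (⊤ : Subrepresentation (ρ.scalarExt L)) := _root_.trivial
    rw [← h] at this
    exact this
  by_cases hX : ∀ x ∈ X, φL x = 0
  · left
    refine Subrepresentation.toSubmodule_injective ((Submodule.eq_bot_iff _).2 fun x hx => ?_)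
    refine LinearMap.eq_zero_of_forall_baseChange (fun g : G => φ ∘ₗ ρ g) hφ fun g => ?_
    rw [LinearMap.baseChange_comp]
    refine (_root_.TensorProduct.AlgebraTensorModule.rid k L L).injective ?_
    rw [map_zero]
    exact hX _ (X.apply_mem_toSubmodule g hx)
  · right
    push Not at hX
    obtain ⟨x, hx, hφx⟩ := hX
    have he' : (1 : L) ⊗ₜ[k] e ∈ X.toSubmodule := by
      have := X.toSubmodule.smul_mem (φL x)⁻¹ (hstable X a hx)
      rwa [hφL, inv_smul_smul₀ hφx] at this
    -- The vectors `v` with `1 ⊗ v ∈ X` form a `G`-stable `k`-subspace of `V` containing `e`.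
    have htop := hspan ((X.toSubmodule.restrictScalars k).comap
      (_root_.TensorProduct.mk k L V 1)) (fun g v hv => X.apply_mem_toSubmodule g hv) he'
    refine Subrepresentation.toSubmodule_injective (Submodule.eq_top_iff'.2 fun x => ?_)
    induction x with
    | zero => exact zero_mem _
    | add x y hx hy => exact add_mem hx hy
    | tmul l v =>
      have hv : v ∈ (⊤ : Submodule k V) := Submodule.mem_top
      rw [← htop] at hv
      have := X.toSubmodule.smul_mem l hv
      rwa [_root_.TensorProduct.mk_apply, _root_.TensorProduct.smul_tmul', smul_eq_mul,
        mul_one] at this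

theorem exists_quotient_pairing {k R M N : Type*} [Field k] [Ring R] [SMul k R]
    [AddCommGroup M] [Module R M] [Module k M] [IsScalarTower k R M]
    [AddCommGroup N] [Module R N] [Module k N] [IsScalarTower k R N]
    (K : Submodule R M) (K' : Submodule R N) (β : M →ₗ[k] N →ₗ[k] k)
    (hK : ∀ x, x ∈ K ↔ ∀ y, β x y = 0) (hK' : ∀ y, y ∈ K' ↔ ∀ x, β x y = 0) :
    ∃ γ : (M ⧸ K) →ₗ[k] (N ⧸ K') →ₗ[k] k,
      (∀ x y, γ (K.mkQ x) (K'.mkQ y) = β x y) ∧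
        Function.Injective γ ∧ Function.Injective γ.flip := by
  let γ₁ : M →ₗ[k] (N ⧸ K'.restrictScalars k) →ₗ[k] k :=
    ((K'.restrictScalars k).liftQ β.flip fun y hy => by
      ext x; exact (hK' y).1 hy x).flip
  let γ₂ : (M ⧸ K.restrictScalars k) →ₗ[k] (N ⧸ K'.restrictScalars k) →ₗ[k] k :=
    (K.restrictScalars k).liftQ γ₁ fun x hx => by
      ext y; exact (hK x).1 hx y
  let γ := γ₂.compl₁₂ (Submodule.Quotient.restrictScalarsEquiv k K).symm.toLinearMap
    (Submodule.Quotient.restrictScalarsEquiv k K').symm.toLinearMap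
  have hγ x y : γ (K.mkQ x) (K'.mkQ y) = β x y := rfl
  refine ⟨γ, hγ, ?_, ?_⟩
  · rw [injective_iff_map_eq_zero]
    intro x hx
    obtain ⟨x, rfl⟩ := K.mkQ_surjective x
    rw [Submodule.mkQ_apply, Submodule.Quotient.mk_eq_zero, hK]
    intro y
    rw [← hγ, hx, LinearMap.zero_apply]
  · rw [injective_iff_map_eq_zero]
    intro y hy
    obtain ⟨y, rfl⟩ := K'.mkQ_surjective y
    rw [Submodule.mkQ_apply, Submodule.Quotient.mk_eq_zero, hK']
    intro x
    rw [← hγ, ← LinearMap.flip_apply, hy, LinearMap.zero_apply]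

theorem nonempty_linearEquiv_contragredientDual {k G D E : Type*} [Field k] [Group G]
    [AddCommGroup D] [Module k D] [Module (MonoidAlgebra k G) D]
    [IsScalarTower k (MonoidAlgebra k G) D]
    [AddCommGroup E] [Module k E] [Module (MonoidAlgebra k G) E]
    [IsScalarTower k (MonoidAlgebra k G) E] [FiniteDimensional k D]
    (γ : D →ₗ[k] E →ₗ[k] k) (hγ : Function.Injective γ) (hγ' : Function.Injective γ.flip)
    (hG : ∀ (g : G) x y, γ (MonoidAlgebra.of k G g • x) y =
      γ x (MonoidAlgebra.of k G g⁻¹ • y)) :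
    Nonempty (D ≃ₗ[MonoidAlgebra k G] ContragredientDual k G E) := by
  let ρ := (Representation.ofModule' (k := k) (G := G) E).dual
  have hp := LinearMap.IsPerfPair.of_injective hγ hγ'
  let f : D ≃ₗ[k] Module.Dual k E := LinearEquiv.ofBijective γ hp.bijective_left
  have hf (r : MonoidAlgebra k G) (x : D) : γ (r • x) = ρ.asAlgebraHom r (γ x) := by
    induction r using MonoidAlgebra.induction_on with
    | of g =>
      ext y
      rw [hG, Representation.asAlgebraHom_of]
      rfl
    | add r s hr hs => rw [add_smul, map_add, map_add, LinearMap.add_apply, hr, hs]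
    | smul c r hr =>
      rw [smul_assoc, LinearMap.map_smul, hr, map_smul ρ.asAlgebraHom, LinearMap.smul_apply]
  exact ⟨{ f.toAddEquiv.trans ρ.asModuleEquiv.symm.toAddEquiv with
    map_smul' := fun r x => ρ.asModuleEquiv.injective
      ((hf r x).trans (ρ.asModuleEquiv_map_smul r _).symm) }⟩

namespace SplitBNPair

/-! ### The rank-one action of `u_σ` and the dichotomy for submodules. -/

section JamesModule

variable {G : Type u} [Group G] {p : ℕ} {P : SplitBNPair G p} {k : Type v} [Field k]

open MonoidAlgebra (of)

theorem smul_mulB (a b : MonoidAlgebra k G) : a • P.mulB k b = P.mulB k (a * b) :=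
  ((P.mulB k).map_smul a b).symm

theorem mulB_smul (c : k) (a : MonoidAlgebra k G) : P.mulB k (c • a) = c • P.mulB k a :=
  LinearMap.map_smul_of_tower _ c a

theorem uSum_eq_sum [Fintype P.U] (σ : P.U →* kˣ) :
    P.uSum σ = ∑ x : P.U, ((σ x : kˣ) : k) • of k G (x : G) :=
  finsum_eq_sum_of_fintype _

/-- The generator `u_σ n₀ b` of `S_σ`. -/
noncomputable def jamesGen (n₀ : P.N) (σ : P.U →* kˣ) : P.PermModule k :=
  P.mulB k (P.uSum σ * of k G (n₀ : G))

theorem jamesGen_mem (n₀ : P.N) (σ : P.U →* kˣ) : jamesGen n₀ σ ∈ P.jamesModule n₀ σ :=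
  Submodule.mem_span_singleton_self _

theorem jamesModule_le_iff (n₀ : P.N) (σ : P.U →* kˣ)
    {X : Submodule (MonoidAlgebra k G) (P.PermModule k)} :
    P.jamesModule n₀ σ ≤ X ↔ jamesGen n₀ σ ∈ X :=
  Submodule.span_singleton_le_iff_mem _ _

variable [Finite G]

theorem of_mul_bSum {b : G} (hb : b ∈ P.B) : of k G b * P.bSum k = P.bSum k := by
  have := Fintype.ofFinite P.B
  simp only [bSum, finsum_eq_sum_of_fintype, Finset.mul_sum, ← map_mul]
  exact Fintype.sum_equiv (Equiv.mulLeft ⟨b, hb⟩) _ _ fun x => rfl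

theorem mulB_of_mul {g b : G} (hb : b ∈ P.B) :
    P.mulB k (of k G (g * b)) = P.mulB k (of k G g) := by
  apply Subtype.ext
  change of k G (g * b) * P.bSum k = of k G g * P.bSum k
  rw [map_mul, mul_assoc, of_mul_bSum hb]

theorem mulB_mul_of_mul (a : MonoidAlgebra k G) {g b : G} (hb : b ∈ P.B) :
    P.mulB k (a * of k G (g * b)) = P.mulB k (a * of k G g) := by
  rw [← smul_mulB, mulB_of_mul hb, smul_mulB]

theorem uSum_mul_of (σ : P.U →* kˣ) (u : P.U) :
    P.uSum σ * of k G (u : G) = ((σ u)⁻¹ : k) • P.uSum σ := by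
  have := Fintype.ofFinite P.U
  simp only [uSum_eq_sum, Finset.sum_mul, Finset.smul_sum, smul_mul_assoc, ← map_mul]
  refine Fintype.sum_equiv (Equiv.mulRight u) _ _ fun x => ?_
  simp [mul_comm]

theorem uSum_mul_uSum (σ : P.U →* kˣ) :
    P.uSum σ * P.uSum σ = (Nat.card P.U : k) • P.uSum σ := by
  have := Fintype.ofFinite P.U
  nth_rw 2 [uSum_eq_sum]
  rw [Finset.mul_sum]
  have h (x : P.U) : P.uSum σ * ((σ x : k) • of k G (x : G)) = P.uSum σ := by
    rw [mul_smul_comm, uSum_mul_of, smul_smul, mul_inv_cancel₀ (σ x).ne_zero, one_smul]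
  rw [Finset.sum_congr rfl fun x _ => h x, Finset.sum_const, Finset.card_univ,
    Nat.card_eq_fintype_card, Nat.cast_smul_eq_nsmul]

theorem form_symm (x y : P.PermModule k) : P.form k x y = P.form k y x := by
  simp only [form_apply, mul_comm]

theorem form_of_smul (g : G) (x y : P.PermModule k) :
    P.form k (of k G g • x) y = P.form k x (of k G g⁻¹ • y) := by
  rw [← P.form_smul_smul g x, smul_smul, ← map_mul, mul_inv_cancel, map_one, one_smul]

/-- By invariance the adjoint of `u` is `u⁻¹`; reindexing the sum by inversion turns `σ` into `σ⁻¹`.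
-/
theorem form_uSum_smul (σ : P.U →* kˣ) (x y : P.PermModule k) :
    P.form k (P.uSum σ • x) y = P.form k x (P.uSum σ⁻¹ • y) := by
  have := Fintype.ofFinite P.U
  simp only [uSum_eq_sum, Finset.sum_smul, map_sum, LinearMap.sum_apply, smul_assoc, map_smul,
    LinearMap.smul_apply]
  refine Fintype.sum_equiv (Equiv.inv P.U) _ _ fun u => ?_
  rw [form_of_smul]
  simp

variable (n₀ : P.N) (σ : P.U →* kˣ)

theorem uSum_smul_jamesGen :
    P.uSum σ • jamesGen n₀ σ = (Nat.card P.U : k) • jamesGen n₀ σ := by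
  rw [jamesGen, smul_mulB, ← mul_assoc, uSum_mul_uSum, smul_mul_assoc, mulB_smul]

variable {n₀ σ}

/-- Only the summand `x = 1` contributes: `x n₀ B = n₀ B` with `x ∈ U` forces `x = 1`. -/
theorem form_jamesGen_of (hn₀ : P.RepresentsLongest n₀) :
    P.form k (jamesGen n₀ σ) (P.mulB k (of k G (n₀ : G))) = 1 := by
  classical
  have := Fintype.ofFinite P.U
  rw [jamesGen, uSum_eq_sum, Finset.sum_mul, map_sum, map_sum, LinearMap.sum_apply,
    Finset.sum_eq_single_of_mem 1 (Finset.mem_univ _)]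
  · simp only [smul_mul_assoc, ← map_mul, mulB_smul, map_smul, LinearMap.smul_apply, form_of_of]
    simp
  · intro x _ hx
    simp only [smul_mul_assoc, ← map_mul, mulB_smul, map_smul, LinearMap.smul_apply, form_of_of]
    rw [if_neg, smul_zero]
    intro h
    rw [QuotientGroup.eq] at h
    refine hx (Subtype.ext (eq_one_of_conj_longest_mem hn₀ x.2 ?_))
    simpa [mul_assoc] using inv_mem h

/-- Choose `x ∈ U_s` with `σ x ≠ 1` and `n⁻¹ x n ∈ B`. Inserting `x` before `n` multiplies the
vector by `(σ x)⁻¹`, yet `x n b = n b`. -/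
theorem mulB_uSum_mul_of_eq_zero (hn₀ : P.RepresentsLongest n₀) (hσ : P.NonDegenerate n₀ σ)
    {n : P.N} (hn : (n : P.W) ≠ n₀) : P.mulB k (P.uSum σ * of k G (n : G)) = 0 := by
  obtain ⟨m, hm, hroot⟩ := exists_rootSubgroup_conj hn₀ hn
  obtain ⟨x, hx, hσx⟩ := hσ m hm
  have h1 : P.mulB k (P.uSum σ * of k G ((x : G) * n)) =
      ((σ x)⁻¹ : k) • P.mulB k (P.uSum σ * of k G (n : G)) := by
    rw [map_mul (of k G), ← mul_assoc, uSum_mul_of, smul_mul_assoc, mulB_smul]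
  have h2 : (x : G) * n = n * ((n : G)⁻¹ * x * n) := by group
  rw [h2, mulB_mul_of_mul _ (hroot _ hx)] at h1
  by_contra hne
  refine hσx (Units.ext ?_)
  have h3 : ((σ x)⁻¹ : k) = 1 := by
    refine smul_left_injective k hne ?_
    simpa using h1.symm
  simpa using h3

theorem exists_uSum_smul_eq (hn₀ : P.RepresentsLongest n₀) (hσ : P.NonDegenerate n₀ σ)
    (x : P.PermModule k) : ∃ c : k, P.uSum σ • x = c • jamesGen n₀ σ := by
  obtain ⟨a, rfl⟩ := P.mulB_surjective x
  induction a using MonoidAlgebra.induction_on with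
  | of g =>
    obtain ⟨u, hu, n, b, hb, rfl⟩ := exists_mul_eq (P := P) g
    rw [mulB_of_mul hb, smul_mulB, map_mul (of k G), ← mul_assoc, uSum_mul_of σ ⟨u, hu⟩, smul_mul_assoc,
      mulB_smul]
    by_cases hn : (n : P.W) = n₀
    · have h2 : (n : G) = n₀ * ((n₀ : G)⁻¹ * n) := by group
      exact ⟨_, by rw [h2, mulB_mul_of_mul _ (coe_eq_coe_iff.1 hn.symm), jamesGen]⟩
    · exact ⟨0, by rw [mulB_uSum_mul_of_eq_zero hn₀ hσ hn, smul_zero, zero_smul]⟩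
  | add a b ha hb =>
    obtain ⟨c, hc⟩ := ha
    obtain ⟨d, hd⟩ := hb
    exact ⟨c + d, by rw [map_add, smul_add, hc, hd, add_smul]⟩
  | smul r a ha =>
    obtain ⟨c, hc⟩ := ha
    exact ⟨r * c, by rw [mulB_smul, smul_comm, hc, smul_smul]⟩

theorem uSum_smul_eq (hn₀ : P.RepresentsLongest n₀) (hσ : P.NonDegenerate n₀ σ)
    (x : P.PermModule k) :
    P.uSum σ • x = P.form k x (jamesGen n₀ σ⁻¹) • jamesGen n₀ σ := by
  obtain ⟨c, hc⟩ := exists_uSum_smul_eq hn₀ hσ x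
  -- Pairing `u_σ x = c e_σ` with `n₀ b` gives `c`; moving `u_σ` across the form gives `⟨x,
  -- e_{σ*}⟩`.
  have h := form_uSum_smul σ x (P.mulB k (of k G (n₀ : G)))
  rw [hc, map_smul, LinearMap.smul_apply, form_jamesGen_of hn₀, smul_eq_mul, mul_one,
    smul_mulB] at h
  rw [hc, h]
  rfl

/-- Compare the two formulas for `u_σ e_σ`: the rank-one formula and `u_σ² = |U| u_σ`. -/
theorem form_jamesGen_jamesGen (hn₀ : P.RepresentsLongest n₀) (hσ : P.NonDegenerate n₀ σ) :
    P.form k (jamesGen n₀ σ) (jamesGen n₀ σ⁻¹) = Nat.card P.U := by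
  have h := congrArg (fun z => P.form k z (P.mulB k (of k G (n₀ : G))))
    ((uSum_smul_eq hn₀ hσ _).symm.trans (uSum_smul_jamesGen n₀ σ))
  simpa only [map_smul, LinearMap.smul_apply, form_jamesGen_of hn₀, smul_eq_mul, mul_one] using h

theorem mem_perp_jamesModule {x : P.PermModule k} :
    x ∈ P.perp (P.jamesModule n₀ σ) ↔
      ∀ g : G, P.form k (of k G g • x) (jamesGen n₀ σ) = 0 := by
  constructor
  · intro h g
    exact (Submodule.smul_mem _ (of k G g) h) _ (jamesGen_mem n₀ σ)
  · intro h y hy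
    obtain ⟨a, rfl⟩ := Submodule.mem_span_singleton.1 hy
    change P.form k x (a • jamesGen n₀ σ) = 0
    induction a using MonoidAlgebra.induction_on with
    | of g =>
      have := h g⁻¹
      rwa [form_of_smul, inv_inv] at this
    | add a b ha hb =>
      rw [add_smul, map_add, ha (Submodule.smul_mem _ _ (jamesGen_mem _ _)),
        hb (Submodule.smul_mem _ _ (jamesGen_mem _ _)), add_zero]
    | smul r a ha =>
      rw [smul_assoc, map_smul, ha (Submodule.smul_mem _ _ (jamesGen_mem _ _)), smul_zero]

theorem jamesModule_le_or_forall_smul_eq_zero (hn₀ : P.RepresentsLongest n₀)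
    (hσ : P.NonDegenerate n₀ σ) (M : Submodule (MonoidAlgebra k G) (P.PermModule k)) :
    P.jamesModule n₀ σ ≤ M ∨ ∀ x ∈ M, P.form k x (jamesGen n₀ σ⁻¹) = 0 := by
  by_contra! H
  obtain ⟨h, x, hx, hne⟩ := H
  refine h ((jamesModule_le_iff _ _).2 ?_)
  have h1 := M.smul_mem (P.uSum σ) hx
  rw [uSum_smul_eq hn₀ hσ] at h1
  have h2 := M.smul_of_tower_mem (P.form k x (jamesGen n₀ σ⁻¹))⁻¹ h1
  rwa [inv_smul_smul₀ hne] at h2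

theorem jamesModule_le_or_le_perp (hn₀ : P.RepresentsLongest n₀)
    (hσ : P.NonDegenerate n₀ σ) (M : Submodule (MonoidAlgebra k G) (P.PermModule k)) :
    P.jamesModule n₀ σ ≤ M ∨ M ≤ P.perp (P.jamesModule n₀ σ⁻¹) :=
  (jamesModule_le_or_forall_smul_eq_zero hn₀ hσ M).imp_right fun h _ hx =>
    mem_perp_jamesModule.2 fun _ => h _ (M.smul_mem _ hx)

theorem jamesModule_not_le_perp (hn₀ : P.RepresentsLongest n₀) (hσ : P.NonDegenerate n₀ σ)
    (hU : (Nat.card P.U : k) ≠ 0) :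
    ¬ P.jamesModule n₀ σ ≤ P.perp (P.jamesModule n₀ σ⁻¹) := fun h =>
  hU (by rw [← form_jamesGen_jamesGen hn₀ hσ]; exact h (jamesGen_mem _ _) _ (jamesGen_mem _ _))

theorem isCoatom_iff_eq_jamesRadical (hn₀ : P.RepresentsLongest n₀)
    (hσ : P.NonDegenerate n₀ σ) (hU : (Nat.card P.U : k) ≠ 0)
    (M : Submodule (MonoidAlgebra k G) (P.jamesModule n₀ σ)) :
    IsCoatom M ↔ M = P.jamesRadical n₀ σ := by
  have hne : P.jamesRadical n₀ σ ≠ ⊤ := fun h =>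
    jamesModule_not_le_perp hn₀ hσ hU (Submodule.submoduleOf_eq_top.1 h)
  have hle (X : Submodule (MonoidAlgebra k G) (P.jamesModule n₀ σ)) (hX : X ≠ ⊤) :
      X ≤ P.jamesRadical n₀ σ := by
    rcases jamesModule_le_or_le_perp hn₀ hσ (X.map (P.jamesModule n₀ σ).subtype) with h | h
    · refine absurd (Submodule.eq_top_iff'.2 fun x => ?_) hX
      obtain ⟨y, hy, hyx⟩ := h x.2
      rwa [← Subtype.ext hyx]
    · exact Submodule.map_le_iff_le_comap.1 h
  constructor
  · intro h
    exact ((hle M h.1).eq_or_lt).resolve_right fun hlt => hne (h.2 _ hlt)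
  · rintro rfl
    exact ⟨hne, fun X hX => by_contra fun h => hX.not_ge (hle X h)⟩

instance : FiniteDimensional k (MonoidAlgebra k G) :=
  Module.Finite.of_basis (MonoidAlgebra.basis ..)

instance : FiniteDimensional k (P.PermModule k) :=
  FiniteDimensional.of_injective ((P.incl k).restrictScalars k) Subtype.val_injective

end JamesModule

end SplitBNPair

namespace SplitBNPair

/-! ### The quotient `D_σ`: duality, absolute irreducibility, multiplicity one. -/

section JamesQuotient

variable {G : Type u} [Group G] [Finite G] {p : ℕ} {P : SplitBNPair G p} {k : Type v} [Field k]
  {n₀ : P.N} {σ : P.U →* kˣ}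

open MonoidAlgebra (of)

theorem exists_jamesQuotient_pairing (n₀ : P.N) (σ : P.U →* kˣ) :
    ∃ γ : P.jamesQuotient n₀ σ →ₗ[k] P.jamesQuotient n₀ σ⁻¹ →ₗ[k] k,
      (∀ x y, γ ((P.jamesRadical n₀ σ).mkQ x) ((P.jamesRadical n₀ σ⁻¹).mkQ y) =
        P.form k x.1 y.1) ∧ Function.Injective γ ∧ Function.Injective γ.flip := by
  refine exists_quotient_pairing (P.jamesRadical n₀ σ) (P.jamesRadical n₀ σ⁻¹)
    ((P.form k).compl₁₂ ((P.jamesModule n₀ σ).subtype.restrictScalars k)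
      ((P.jamesModule n₀ σ⁻¹).subtype.restrictScalars k)) (fun x => ?_) (fun y => ?_)
  · exact ⟨fun h y => h y.1 y.2, fun h y hy => h ⟨y, hy⟩⟩
  -- The right kernel is the radical for `σ⁻¹`, defined by orthogonality to the module for `σ⁻¹⁻¹`.
  · have hinv : σ⁻¹⁻¹ = σ := inv_inv σ
    refine ⟨fun h x => ?_, fun h x hx => ?_⟩
    · exact (form_symm _ _).trans (h x.1 (by rw [hinv]; exact x.2))
    · rw [hinv] at hx
      exact (form_symm _ _).trans (h ⟨x, hx⟩)

theorem jamesQuotient_pairing_of_smul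
    {γ : P.jamesQuotient n₀ σ →ₗ[k] P.jamesQuotient n₀ σ⁻¹ →ₗ[k] k}
    (hγ : ∀ x y, γ ((P.jamesRadical n₀ σ).mkQ x) ((P.jamesRadical n₀ σ⁻¹).mkQ y) =
      P.form k x.1 y.1) (g : G) (x : P.jamesQuotient n₀ σ) (y : P.jamesQuotient n₀ σ⁻¹) :
    γ (of k G g • x) y = γ x (of k G g⁻¹ • y) := by
  obtain ⟨x, rfl⟩ := Submodule.mkQ_surjective _ x
  obtain ⟨y, rfl⟩ := Submodule.mkQ_surjective _ y
  rw [← map_smul, ← map_smul, hγ, hγ]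
  exact form_of_smul g _ _

instance : FiniteDimensional k (P.jamesModule n₀ σ) :=
  FiniteDimensional.of_injective ((P.jamesModule n₀ σ).subtype.restrictScalars k)
    Subtype.val_injective

instance : FiniteDimensional k (P.jamesQuotient n₀ σ) :=
  Module.Finite.of_surjective ((P.jamesRadical n₀ σ).mkQ.restrictScalars k)
    (P.jamesRadical n₀ σ).mkQ_surjective

theorem nonempty_jamesQuotient_equiv_contragredientDual (n₀ : P.N) (σ : P.U →* kˣ) :
    Nonempty (P.jamesQuotient n₀ σ ≃ₗ[MonoidAlgebra k G]
      ContragredientDual k G (P.jamesQuotient n₀ σ⁻¹)) := by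
  obtain ⟨γ, hγ, h1, h2⟩ := exists_jamesQuotient_pairing n₀ σ
  exact nonempty_linearEquiv_contragredientDual γ h1 h2 (jamesQuotient_pairing_of_smul hγ)

/-- The generator of `D_σ`. -/
noncomputable def jamesQuotientGen (n₀ : P.N) (σ : P.U →* kˣ) : P.jamesQuotient n₀ σ :=
  (P.jamesRadical n₀ σ).mkQ ⟨jamesGen n₀ σ, jamesGen_mem n₀ σ⟩

theorem jamesQuotientGen_ne_zero (hn₀ : P.RepresentsLongest n₀) (hσ : P.NonDegenerate n₀ σ)
    (hU : (Nat.card P.U : k) ≠ 0) : jamesQuotientGen n₀ σ ≠ 0 := fun h =>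
  jamesModule_not_le_perp hn₀ hσ hU
    ((jamesModule_le_iff _ _).2 ((Submodule.Quotient.mk_eq_zero (P.jamesRadical n₀ σ)).1 h))

theorem eq_top_of_jamesQuotientGen_mem {X : Submodule (MonoidAlgebra k G) (P.jamesQuotient n₀ σ)}
    (hX : jamesQuotientGen n₀ σ ∈ X) : X = ⊤ := by
  refine Submodule.eq_top_iff'.2 fun x => ?_
  obtain ⟨⟨x, hx⟩, rfl⟩ := Submodule.mkQ_surjective _ x
  obtain ⟨a, rfl⟩ := Submodule.mem_span_singleton.1 hx
  exact X.smul_mem a hX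

theorem uSum_smul_jamesQuotient (hn₀ : P.RepresentsLongest n₀) (hσ : P.NonDegenerate n₀ σ)
    {γ : P.jamesQuotient n₀ σ →ₗ[k] P.jamesQuotient n₀ σ⁻¹ →ₗ[k] k}
    (hγ : ∀ x y, γ ((P.jamesRadical n₀ σ).mkQ x) ((P.jamesRadical n₀ σ⁻¹).mkQ y) =
      P.form k x.1 y.1) (x : P.jamesQuotient n₀ σ) :
    P.uSum σ • x = γ x (jamesQuotientGen n₀ σ⁻¹) • jamesQuotientGen n₀ σ := by
  obtain ⟨x, rfl⟩ := Submodule.mkQ_surjective _ x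
  rw [jamesQuotientGen, hγ, ← map_smul]
  exact congrArg (P.jamesRadical n₀ σ).mkQ (Subtype.ext (uSum_smul_eq hn₀ hσ x.1))

theorem isAbsolutelyIrreducible_jamesQuotient (hn₀ : P.RepresentsLongest n₀)
    (hσ : P.NonDegenerate n₀ σ) (hU : (Nat.card P.U : k) ≠ 0) :
    IsAbsolutelyIrreducible.{w} k G (P.jamesQuotient n₀ σ) := by
  intro L _ _
  obtain ⟨γ, hγ, h1, -⟩ := exists_jamesQuotient_pairing n₀ σ
  have hact (a : MonoidAlgebra k G) (x : P.jamesQuotient n₀ σ) :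
      (Representation.ofModule' (k := k) (G := G) (P.jamesQuotient n₀ σ)).asAlgebraHom a x =
        a • x := by
    induction a using MonoidAlgebra.induction_on with
    | of g => rw [Representation.asAlgebraHom_of]; rfl
    | add a b ha hb => rw [map_add, LinearMap.add_apply, ha, hb, add_smul]
    | smul c a ha => rw [map_smul, LinearMap.smul_apply, ha, smul_assoc]
  refine Representation.isIrreducible_scalarExt _ (P.uSum σ) (jamesQuotientGen n₀ σ)
    (γ.flip (jamesQuotientGen n₀ σ⁻¹)) (fun x => ?_) (jamesQuotientGen_ne_zero hn₀ hσ hU)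
    (fun X hX he => ?_) (fun x hx => ?_) L
  · rw [hact, uSum_smul_jamesQuotient hn₀ hσ hγ, LinearMap.flip_apply]
  · let Y : Submodule (MonoidAlgebra k G) (P.jamesQuotient n₀ σ) :=
      { X with
        smul_mem' := fun a x hx => by
          induction a using MonoidAlgebra.induction_on with
          | of g => exact hX g x hx
          | add a b ha hb => rw [add_smul]; exact X.add_mem ha hb
          | smul c a ha => rw [smul_assoc]; exact X.smul_mem c ha }
    have hY : Y = ⊤ := eq_top_of_jamesQuotientGen_mem he
    refine Submodule.eq_top_iff'.2 fun x => ?_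
    have : x ∈ Y := hY ▸ Submodule.mem_top
    exact this
  · obtain ⟨x, rfl⟩ := Submodule.mkQ_surjective _ x
    rw [Submodule.mkQ_apply, Submodule.Quotient.mk_eq_zero]
    refine mem_perp_jamesModule.2 fun g => ?_
    have := hγ (of k G g • x) ⟨jamesGen n₀ σ⁻¹, jamesGen_mem n₀ σ⁻¹⟩
    rw [map_smul] at this
    exact this.symm.trans (hx g)

/-- Allowing any `M` between `S_σ` and `kG b` covers both multiplicity claims at once, with `M = kG
b` and `M = S_σ`. -/
theorem occursWithMultiplicity_one_of_linearMap (hn₀ : P.RepresentsLongest n₀)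
    (hσ : P.NonDegenerate n₀ σ) (hU : (Nat.card P.U : k) ≠ 0) {M : Type*} [AddCommGroup M]
    [Module (MonoidAlgebra k G) M] (i : M →ₗ[MonoidAlgebra k G] P.PermModule k)
    (hi : Function.Injective i) (j : P.jamesModule n₀ σ →ₗ[MonoidAlgebra k G] M)
    (hij : i ∘ₗ j = (P.jamesModule n₀ σ).subtype) :
    OccursWithMultiplicity (MonoidAlgebra k G) M (P.jamesQuotient n₀ σ) 1 := by
  have hij' (x) : i (j x) = x := LinearMap.congr_fun hij x
  have : IsNoetherian (MonoidAlgebra k G) (P.PermModule k) := isNoetherian_of_tower k inferInstance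
  have : IsArtinian (MonoidAlgebra k G) (P.PermModule k) := isArtinian_of_tower k inferInstance
  have : IsNoetherian (MonoidAlgebra k G) M := isNoetherian_of_injective i hi
  have : IsArtinian (MonoidAlgebra k G) M := isArtinian_of_injective i hi
  have hgen : jamesQuotientGen n₀ σ ≠ 0 := jamesQuotientGen_ne_zero hn₀ hσ hU
  have hsmul (x : M) : i (P.uSum σ • x) =
      P.form k (i x) (jamesGen n₀ σ⁻¹) • jamesGen n₀ σ := by
    rw [map_smul, uSum_smul_eq hn₀ hσ]
  have hmem (x : M) : P.uSum σ • x =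
      j (P.form k (i x) (jamesGen n₀ σ⁻¹) • ⟨jamesGen n₀ σ, jamesGen_mem n₀ σ⟩) := by
    apply hi
    rw [hsmul, hij']
    rfl
  refine occursWithMultiplicity_one (isCoatom_iff_eq_jamesRadical hn₀ hσ hU) j ?_ (P.uSum σ)
    (fun x => ⟨_, (hmem x).symm⟩) (fun X => ?_) ⟨jamesQuotientGen n₀ σ, ?_⟩
  · rintro rfl
    refine hgen ?_
    rw [jamesQuotientGen, Submodule.mkQ_apply, Submodule.Quotient.mk_eq_zero]
    have h0 : (⟨jamesGen n₀ σ, jamesGen_mem n₀ σ⟩ : P.jamesModule n₀ σ) = 0 :=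
      Subtype.ext ((hij' _).symm.trans (map_zero i))
    rw [h0]
    exact zero_mem _
  · refine (jamesModule_le_or_forall_smul_eq_zero hn₀ hσ (X.map i)).imp (fun h => ?_)
      (fun h x hx => hi ?_)
    · rintro _ ⟨y, rfl⟩
      obtain ⟨z, hz, hzy⟩ := h y.2
      rw [← hij' y] at hzy
      rwa [← hi hzy]
    · rw [hsmul, h _ ⟨x, hx, rfl⟩, zero_smul, map_zero]
  · have : P.uSum σ • jamesQuotientGen n₀ σ = (Nat.card P.U : k) • jamesQuotientGen n₀ σ := by
      rw [jamesQuotientGen, ← map_smul]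
      exact congrArg (P.jamesRadical n₀ σ).mkQ (Subtype.ext (uSum_smul_jamesGen n₀ σ))
    rw [this]
    exact smul_ne_zero hU hgen

end JamesQuotient

end SplitBNPair

theorem proposition2p1 {G : Type u} [Group G] [Finite G] {p : ℕ} (hp : p.Prime)
    (P : SplitBNPair G p) (n₀ : P.N) (hn₀ : P.RepresentsLongest n₀)
    {k : Type v} [Field k] (hU : (Nat.card P.U : k) ≠ 0)
    (σ : P.U →* kˣ) (hσ : P.NonDegenerate n₀ σ) :
    -- (i)
    (∀ M : Submodule (MonoidAlgebra k G) (P.PermModule k),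
      P.jamesModule n₀ σ ≤ M ∨ M ≤ P.perp (P.jamesModule n₀ σ⁻¹)) ∧
    -- (ii)
    (¬ P.jamesModule n₀ σ ≤ P.perp (P.jamesModule n₀ σ⁻¹) ∧
      P.jamesModule n₀ σ ⊓ P.perp (P.jamesModule n₀ σ⁻¹) < P.jamesModule n₀ σ ∧
      ∀ M : Submodule (MonoidAlgebra k G) (P.jamesModule n₀ σ),
        IsCoatom M ↔ M = P.jamesRadical n₀ σ) ∧
    -- (iii)
    (IsAbsolutelyIrreducible.{w} k G (P.jamesQuotient n₀ σ) ∧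
      Nonempty (P.jamesQuotient n₀ σ ≃ₗ[MonoidAlgebra k G]
        ContragredientDual k G (P.jamesQuotient n₀ σ⁻¹))) ∧
    -- (iv)
    (OccursWithMultiplicity (MonoidAlgebra k G) (P.PermModule k) (P.jamesQuotient n₀ σ) 1 ∧
      OccursWithMultiplicity (MonoidAlgebra k G) (P.jamesModule n₀ σ)
        (P.jamesQuotient n₀ σ) 1) := by
  have hnle := SplitBNPair.jamesModule_not_le_perp hn₀ hσ hU
  exact ⟨SplitBNPair.jamesModule_le_or_le_perp hn₀ hσ,
    ⟨hnle, inf_le_left.lt_of_ne fun h => hnle (inf_eq_left.1 h),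
      SplitBNPair.isCoatom_iff_eq_jamesRadical hn₀ hσ hU⟩,
    ⟨SplitBNPair.isAbsolutelyIrreducible_jamesQuotient hn₀ hσ hU,
      SplitBNPair.nonempty_jamesQuotient_equiv_contragredientDual n₀ σ⟩,
    SplitBNPair.occursWithMultiplicity_one_of_linearMap hn₀ hσ hU LinearMap.id
      Function.injective_id (P.jamesModule n₀ σ).subtype rfl,
    SplitBNPair.occursWithMultiplicity_one_of_linearMap hn₀ hσ hU (P.jamesModule n₀ σ).subtype
      Subtype.val_injective LinearMap.id rfl⟩
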